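/- Let $\mathcal{H}$ be a complex separable (finite- or infinite-dimensional) Hilbert space with $\dim\mathcal{H}\ge 2$, let $\{e_i\}_i$ be a fixed orthonormal basis of $\mathcal{H}$, let $\mathcal{B}(\mathcal{K})$ denote the bounded operators on a Hilbert space $\mathcal{K}$ with the operator norm, and let $\mathcal{T}(\mathcal{H})$ be the space of trace class operators on $\mathcal{H}$ with the trace norm $\|X\|_1=\operatorname{tr}|X|$. Let $S\in\mathcal{B}(\mathcal{H}\otimes\mathcal{H})$ be the swap operator, $S(x\otimes y)=y\otimes x$, and let $\Phi:\mathcal{T}(\mathcal{H})\to\mathcal{B}(\mathcal{H}\otimes\mathcal{H})$ be a continuous linear map. Say that $\Phi$ is *covariant under unitary evolution* if $\Phi(UXU^*)=(U\otimes U)\Phi(X)(U^*\otimes U^*)$ for all $X\in\mathcal{T}(\mathcal{H})$ and all unitary $U\in\mathcal{B}(\mathcal{H})$, and that $\Phi$ is *consistent with classical broadcasting* if $(\mathcal{D}\otimes\mathcal{D})(\Phi(\mathcal{D}(X)))=\mathcal{B}_{cl}(X)$ for all $X\in\mathcal{T}(\mathcal{H})$. Here, with strongly convergent sums, $$\mathcal{D}(X)=\sum_i\langle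 Xe_i,e_i\rangle\, e_ie_i^*,\qquad \mathcal{B}_{cl}(X)=\sum_i\langle Xe_i,e_i\rangle\, e_ie_i^*\otimes e_ie_i^*,$$ $$(\mathcal{D}\otimes\mathcal{D})(T)=\sum_{i,j}\langle T(e_i\otimes e_j),e_i\otimes e_j\rangle\, e_ie_i^*\otimes e_je_j^*\qquad (T\in\mathcal{B}(\mathcal{H}\otimes\mathcal{H})).$$ Then $\Phi$ is covariant under unitary evolution and consistent with classical broadcasting if and only if there exists $\mu\in\mathbb{C}$ such that $$\Phi(X)=\mu\, S(I\otimes X)+(1-\mu)\, S(X\otimes I)\qquad\text{for all } X\in\mathcal{T}(\mathcal{H}).$$ Moreover, if $\mathcal{H}$ is finite-dimensional and $\Phi$ is covariant under unitary evolution and consistent with classical broadcasting, then $\operatorname{tr}_1[\Phi(X)]=\operatorname{tr}_2[\Phi(X)]=X$ for all $X\in\mathcal{T}(\mathcal{H})$, where $\operatorname{tr}_1(A\otimes B)=\operatorname{tr}(A)B$ and $\operatorname{tr}_2(A\otimes B)=\operatorname{tr}(B)A$ are the partial traces. -/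

import Mathlib

open scoped InnerProductSpace TensorProduct ENNReal

noncomputable section

set_option linter.unusedSectionVars false

namespace Broadcasting

/-! ### Trace class operators -/

section TraceClass

variable {H : Type*} [NormedAddCommGroup H] [InnerProductSpace ℂ H] [CompleteSpace H]

/-- The absolute value `|X| = (X* X)^{1/2}`. -/
abbrev absOp (X : H →L[ℂ] H) : H →L[ℂ] H := CFC.abs X

/-- `tr A = ∑ i, ⟨A e_i, e_i⟩` for a positive operator `A`, as an extended nonnegative number,
computed in the orthonormal basis `e`. -/
def posTrace {ι : Type*} (e : HilbertBasis ι ℂ H) (A : H →L[ℂ] H) : ℝ≥0∞ :=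
  ∑' i, ENNReal.ofReal (RCLike.re ⟪e i, A (e i)⟫_ℂ)

variable (H) in
/-- Some orthonormal basis of `H`. -/
def someBasis : HilbertBasis (exists_hilbertBasis ℂ H).choose ℂ H :=
  (exists_hilbertBasis ℂ H).choose_spec.choose

/-- The trace norm `‖X‖₁ = tr |X|`, with values in `[0, ∞]`. The basis is irrelevant by
`traceNorm_eq_posTrace`. -/
def traceNorm (X : H →L[ℂ] H) : ℝ≥0∞ := posTrace (someBasis H) (absOp X)

/-- The square of the Hilbert-Schmidt norm. -/
def hsSq {ι : Type*} (e : HilbertBasis ι ℂ H) (A : H →L[ℂ] H) : ℝ≥0∞ :=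
  ∑' i, ‖A (e i)‖ₑ ^ 2

lemma dense_span_basis {K : Type*} [NormedAddCommGroup K] [InnerProductSpace ℂ K]
    {ι : Type*} (e : HilbertBasis ι ℂ K) :
    Dense (Submodule.span ℂ (Set.range e) : Set K) :=
  Submodule.dense_iff_topologicalClosure_eq_top.2 e.dense_span

lemma parseval {ι : Type*} (e : HilbertBasis ι ℂ H) (x : H) :
    ‖x‖ₑ ^ 2 = ∑' i, ‖⟪e i, x⟫_ℂ‖ₑ ^ 2 := by
  have h1 := e.hasSum_inner_mul_inner x x
  have h2 : ∀ i, ⟪x, e i⟫_ℂ * ⟪e i, x⟫_ℂ = ((‖⟪e i, x⟫_ℂ‖ ^ 2 : ℝ) : ℂ) := by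
    intro i
    rw [← inner_conj_symm, mul_comm, RCLike.mul_conj]
    push_cast
    rfl
  simp only [h2] at h1
  rw [inner_self_eq_norm_sq_to_K] at h1
  have h3 : HasSum (fun i => ‖⟪e i, x⟫_ℂ‖ ^ 2) (‖x‖ ^ 2) := by
    refine Complex.hasSum_ofReal.1 ?_
    rw [Complex.ofReal_pow]
    exact h1
  have h4 := ENNReal.ofReal_tsum_of_nonneg (fun i => by positivity) h3.summable
  rw [h3.tsum_eq] at h4
  simpa [ENNReal.ofReal_pow] using h4

lemma hsSq_adjoint {ι κ : Type*} (e : HilbertBasis ι ℂ H) (f : HilbertBasis κ ℂ H)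
    (A : H →L[ℂ] H) : hsSq e A = hsSq f (star A) := by
  simp only [hsSq]
  simp_rw [parseval f (A _), parseval e ((star A) _)]
  rw [ENNReal.tsum_comm]
  refine tsum_congr fun j => tsum_congr fun i => ?_
  rw [ContinuousLinearMap.star_eq_adjoint, ContinuousLinearMap.adjoint_inner_right,
    ← inner_conj_symm, RCLike.enorm_conj]

lemma hsSq_basis {ι κ : Type*} (e : HilbertBasis ι ℂ H) (f : HilbertBasis κ ℂ H)
    (A : H →L[ℂ] H) : hsSq e A = hsSq f A := by
  rw [hsSq_adjoint e f A, hsSq_adjoint f f (star A), star_star]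

lemma hsSq_mul_left {ι : Type*} (e : HilbertBasis ι ℂ H) (C A : H →L[ℂ] H) (hC : ‖C‖ ≤ 1) :
    hsSq e (C * A) ≤ hsSq e A := by
  refine ENNReal.tsum_le_tsum fun i => ?_
  gcongr
  rw [enorm_le_iff_norm_le]
  exact (C.le_opNorm _).trans (mul_le_of_le_one_left (norm_nonneg _) hC)

lemma hsSq_mul_right {ι : Type*} (e : HilbertBasis ι ℂ H) (A C : H →L[ℂ] H) (hC : ‖C‖ ≤ 1) :
    hsSq e (A * C) ≤ hsSq e A := by
  rw [hsSq_adjoint e e, hsSq_adjoint e e A, star_mul]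
  exact hsSq_mul_left e _ _ (by rwa [norm_star])

/-- The square root of `|X|`. -/
abbrev sqrtAbs (X : H →L[ℂ] H) : H →L[ℂ] H := CFC.sqrt (absOp X)

lemma sqrtAbs_mul_self (X : H →L[ℂ] H) : sqrtAbs X * sqrtAbs X = absOp X :=
  CFC.sqrt_mul_sqrt_self _ (CFC.abs_nonneg X)

lemma star_sqrtAbs (X : H →L[ℂ] H) : star (sqrtAbs X) = sqrtAbs X :=
  (IsSelfAdjoint.of_nonneg (CFC.sqrt_nonneg _)).star_eq

lemma inner_absOp (X : H →L[ℂ] H) (x : H) :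
    RCLike.re ⟪x, absOp X x⟫_ℂ = ‖sqrtAbs X x‖ ^ 2 := by
  rw [← sqrtAbs_mul_self, mul_apply_eq_comp]
  nth_rewrite 1 [← star_sqrtAbs]
  rw [ContinuousLinearMap.star_eq_adjoint, ContinuousLinearMap.adjoint_inner_right,
    inner_self_eq_norm_sq]

lemma posTrace_absOp {ι : Type*} (e : HilbertBasis ι ℂ H) (X : H →L[ℂ] H) :
    posTrace e (absOp X) = hsSq e (sqrtAbs X) := by
  simp only [posTrace, hsSq, inner_absOp]
  simp [ENNReal.ofReal_pow]

/-- The trace norm may be computed in every orthonormal basis. -/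
lemma traceNorm_eq_posTrace {ι : Type*} (e : HilbertBasis ι ℂ H) (X : H →L[ℂ] H) :
    traceNorm X = posTrace e (absOp X) := by
  rw [traceNorm, posTrace_absOp, posTrace_absOp, hsSq_basis]

lemma exists_contraction (A B : H →L[ℂ] H) (h : ∀ x, ‖A x‖ ≤ ‖B x‖) :
    ∃ W : H →L[ℂ] H, ‖W‖ ≤ 1 ∧ A = W * B := by
  let K : Submodule ℂ H := B.range.topologicalClosure
  let e : H →ₗ[ℂ] K := (B : H →ₗ[ℂ] H).codRestrict K
    (fun x => Submodule.le_topologicalClosure _ (LinearMap.mem_range_self _ x))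
  have he : DenseRange e := by
    have h1 : Set.range (Subtype.val ∘ e) = (B.range : Set H) := by
      ext y; simp [e]
    rw [DenseRange, dense_iff_closure_eq, Set.eq_univ_iff_forall]
    intro y
    rw [closure_subtype, ← Set.range_comp, h1]
    exact y.2
  have hn : ∀ x, ‖(A : H →ₗ[ℂ] H) x‖ ≤ 1 * ‖e x‖ := by
    intro x
    simpa [e] using h x
  have : CompleteSpace K := B.range.isClosed_topologicalClosure.completeSpace_coe
  let W0 : K →L[ℂ] H := (A : H →ₗ[ℂ] H).extendOfNorm e
  have hW0 : ‖W0‖ ≤ 1 := LinearMap.opNorm_extendOfNorm_le he zero_le_one hn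
  refine ⟨W0 ∘L K.orthogonalProjectionOnto, ?_, ?_⟩
  · refine (ContinuousLinearMap.opNorm_comp_le _ _).trans ?_
    have := K.orthogonalProjectionOnto_norm_le
    nlinarith [norm_nonneg W0, norm_nonneg K.orthogonalProjectionOnto]
  · ext x
    have h2 : K.orthogonalProjectionOnto (B x) = e x :=
      K.orthogonalProjectionOnto_mem_subspace_eq_self (e x)
    simp only [mul_apply_eq_comp, ContinuousLinearMap.comp_apply, h2]
    exact (LinearMap.extendOfNorm_eq he ⟨1, hn⟩ x).symm

lemma norm_absOp_apply (X : H →L[ℂ] H) (x : H) : ‖absOp X x‖ = ‖X x‖ := by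
  have h1 : star (absOp X) = absOp X := (IsSelfAdjoint.of_nonneg (CFC.abs_nonneg X)).star_eq
  have h2 : ⟪absOp X x, absOp X x⟫_ℂ = ⟪X x, X x⟫_ℂ := by
    rw [← ContinuousLinearMap.adjoint_inner_right, ← ContinuousLinearMap.star_eq_adjoint, h1,
      ← mul_apply_eq_comp, CFC.abs_mul_abs, mul_apply_eq_comp,
      ContinuousLinearMap.star_eq_adjoint, ContinuousLinearMap.adjoint_inner_right]
  rw [inner_self_eq_norm_sq_to_K, inner_self_eq_norm_sq_to_K] at h2
  have h3 : ‖absOp X x‖ ^ 2 = ‖X x‖ ^ 2 := by exact_mod_cast h2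
  exact (pow_left_inj₀ (norm_nonneg _) (norm_nonneg _) two_ne_zero).1 h3

lemma exists_polar (X : H →L[ℂ] H) : ∃ W : H →L[ℂ] H, ‖W‖ ≤ 1 ∧ X = W * absOp X :=
  exists_contraction _ _ fun x => (norm_absOp_apply X x).ge

lemma exists_polar' (X : H →L[ℂ] H) : ∃ W : H →L[ℂ] H, ‖W‖ ≤ 1 ∧ absOp X = W * X :=
  exists_contraction _ _ fun x => (norm_absOp_apply X x).le

lemma tsum_inner_le {ι : Type*} (e : HilbertBasis ι ℂ H) (C X B : H →L[ℂ] H)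
    (hC : ‖C‖ ≤ 1) (hB : ‖B‖ ≤ 1) :
    ∑' i, ‖⟪e i, (C * X * B) (e i)⟫_ℂ‖ₑ ≤ traceNorm X := by
  obtain ⟨W, hW, hX⟩ := exists_polar X
  have hCW : ‖C * W‖ ≤ 1 := (norm_mul_le _ _).trans (mul_le_one₀ hC (norm_nonneg _) hW)
  have h1 : hsSq e (star (C * W * sqrtAbs X)) ≤ traceNorm X := by
    rw [← hsSq_adjoint e e, traceNorm_eq_posTrace e, posTrace_absOp]
    exact hsSq_mul_left e _ _ hCW
  have h2 : hsSq e (sqrtAbs X * B) ≤ traceNorm X := by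
    rw [traceNorm_eq_posTrace e, posTrace_absOp]
    exact hsSq_mul_right e _ _ hB
  have h3 : C * X * B = (C * W * sqrtAbs X) * (sqrtAbs X * B) := by
    conv_lhs => rw [hX, ← sqrtAbs_mul_self]
    simp only [mul_assoc]
  have h4 : ∀ i, 2 * ‖⟪e i, (C * X * B) (e i)⟫_ℂ‖ₑ ≤
      ‖star (C * W * sqrtAbs X) (e i)‖ₑ ^ 2 + ‖(sqrtAbs X * B) (e i)‖ₑ ^ 2 := by
    intro i
    rw [h3, mul_apply_eq_comp, ← ContinuousLinearMap.adjoint_inner_left,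
      ← ContinuousLinearMap.star_eq_adjoint]
    generalize star (C * W * sqrtAbs X) (e i) = x
    generalize (sqrtAbs X * B) (e i) = y
    have h5 : 2 * ‖⟪x, y⟫_ℂ‖ ≤ ‖x‖ ^ 2 + ‖y‖ ^ 2 := by
      nlinarith [norm_inner_le_norm (𝕜 := ℂ) x y, sq_nonneg (‖x‖ - ‖y‖)]
    have h6 := ENNReal.ofReal_le_ofReal h5
    rw [ENNReal.ofReal_mul (by norm_num), ENNReal.ofReal_add (by positivity) (by positivity),
      ENNReal.ofReal_pow (by positivity), ENNReal.ofReal_pow (by positivity)] at h6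
    simpa using h6
  have h7 : 2 * ∑' i, ‖⟪e i, (C * X * B) (e i)⟫_ℂ‖ₑ ≤ 2 * traceNorm X := by
    rw [← ENNReal.tsum_mul_left, two_mul (traceNorm X)]
    refine (ENNReal.tsum_le_tsum h4).trans ?_
    rw [ENNReal.tsum_add]
    exact add_le_add h1 h2
  exact (ENNReal.mul_le_mul_iff_right (by norm_num) (by norm_num)).1 h7

lemma posTrace_le {ι : Type*} (e : HilbertBasis ι ℂ H) (A : H →L[ℂ] H) :
    posTrace e A ≤ ∑' i, ‖⟪e i, A (e i)⟫_ℂ‖ₑ := by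
  refine ENNReal.tsum_le_tsum fun i => ?_
  rw [← ofReal_norm]
  exact ENNReal.ofReal_le_ofReal (RCLike.re_le_norm _)

lemma traceNorm_add_le (X Y : H →L[ℂ] H) : traceNorm (X + Y) ≤ traceNorm X + traceNorm Y := by
  obtain ⟨W, hW, h⟩ := exists_polar' (X + Y)
  have h1 : ‖(1 : H →L[ℂ] H)‖ ≤ 1 := ContinuousLinearMap.norm_id_le
  rw [traceNorm, h]
  refine (posTrace_le _ _).trans ?_
  refine le_trans ?_ (add_le_add (tsum_inner_le (someBasis H) W X 1 hW h1)
    (tsum_inner_le (someBasis H) W Y 1 hW h1))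
  rw [← ENNReal.tsum_add]
  refine ENNReal.tsum_le_tsum fun i => ?_
  rw [mul_add, add_apply, inner_add_right]
  simpa using enorm_add_le _ _

lemma traceNorm_mul_mul_le (C X B : H →L[ℂ] H) (hC : ‖C‖ ≤ 1) (hB : ‖B‖ ≤ 1) :
    traceNorm (C * X * B) ≤ traceNorm X := by
  obtain ⟨W, hW, h⟩ := exists_polar' (C * X * B)
  have h1 : ‖W * C‖ ≤ 1 := (norm_mul_le _ _).trans (mul_le_one₀ hW (norm_nonneg _) hC)
  rw [traceNorm, h]
  refine (posTrace_le _ _).trans ?_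
  simpa only [mul_assoc] using tsum_inner_le (someBasis H) (W * C) X B h1 hB

lemma traceNorm_smul (a : ℂ) (X : H →L[ℂ] H) : traceNorm (a • X) = ‖a‖ₑ * traceNorm X := by
  rw [traceNorm, traceNorm, posTrace, posTrace, ← ENNReal.tsum_mul_left]
  refine tsum_congr fun i => ?_
  rw [absOp, CFC.abs_smul]
  rw [← ofReal_norm, ← ENNReal.ofReal_mul (norm_nonneg a)]
  congr 1
  rw [smul_apply, inner_smul_right_eq_smul, RCLike.smul_re]

lemma traceNorm_zero : traceNorm (0 : H →L[ℂ] H) = 0 := by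
  simpa using traceNorm_smul 0 (0 : H →L[ℂ] H)

lemma eq_zero_of_traceNorm (X : H →L[ℂ] H) (h : traceNorm X = 0) : X = 0 := by
  rw [traceNorm, posTrace_absOp, hsSq, ENNReal.tsum_eq_zero] at h
  have h1 : sqrtAbs X = 0 := by
    refine ContinuousLinearMap.ext_on (dense_span_basis (someBasis H)) ?_
    rintro _ ⟨i, rfl⟩
    simpa using h i
  obtain ⟨W, -, hX⟩ := exists_polar X
  rw [hX, ← sqrtAbs_mul_self, h1]
  simp

variable (H) in
/-- The trace class operators, those with `tr |X| < ∞`, as a linear subspace of `B(H)`. -/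
def traceClassSubmodule : Submodule ℂ (H →L[ℂ] H) where
  carrier := {X | traceNorm X < ∞}
  zero_mem' := by simp [traceNorm_zero]
  add_mem' {X Y} hX hY := (traceNorm_add_le X Y).trans_lt (ENNReal.add_lt_top.2 ⟨hX, hY⟩)
  smul_mem' a X hX := by
    simp only [Set.mem_ofPred_eq, traceNorm_smul] at hX ⊢
    exact ENNReal.mul_lt_top enorm_lt_top hX

variable (H) in
/-- The space `T(H)` of trace class operators. It carries the trace norm (see below), not the
operator norm. -/
def TraceClass : Type _ := traceClassSubmodule H

instance : AddCommGroup (TraceClass H) := inferInstanceAs (AddCommGroup (traceClassSubmodule H))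

instance : Module ℂ (TraceClass H) := inferInstanceAs (Module ℂ (traceClassSubmodule H))

namespace TraceClass

/-- A trace class operator, as a bounded operator. -/
def toOp : TraceClass H →ₗ[ℂ] (H →L[ℂ] H) := (traceClassSubmodule H).subtype

/-- An operator with finite trace norm, as an element of `T(H)`. -/
def mk (X : H →L[ℂ] H) (hX : traceNorm X < ∞) : TraceClass H := ⟨X, hX⟩

@[simp] lemma toOp_mk (X : H →L[ℂ] H) (hX : traceNorm X < ∞) : (mk X hX).toOp = X := rfl

lemma traceNorm_lt_top (X : TraceClass H) : traceNorm X.toOp < ∞ := Subtype.property X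

lemma toOp_injective : Function.Injective (toOp : TraceClass H → (H →L[ℂ] H)) :=
  Subtype.val_injective

/-- The norm on `T(H)` is the trace norm. -/
instance : Norm (TraceClass H) := ⟨fun X => (traceNorm X.toOp).toReal⟩

lemma norm_def (X : TraceClass H) : ‖X‖ = (traceNorm X.toOp).toReal := rfl

lemma normCore : NormedSpace.Core ℂ (TraceClass H) where
  norm_nonneg X := ENNReal.toReal_nonneg
  norm_smul a X := by
    rw [norm_def, norm_def, map_smul, traceNorm_smul, ENNReal.toReal_mul, toReal_enorm]
  norm_triangle X Y := by
    rw [norm_def, norm_def, norm_def, map_add,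
      ← ENNReal.toReal_add X.traceNorm_lt_top.ne Y.traceNorm_lt_top.ne]
    exact ENNReal.toReal_mono
      (ENNReal.add_lt_top.2 ⟨X.traceNorm_lt_top, Y.traceNorm_lt_top⟩).ne (traceNorm_add_le _ _)
  norm_eq_zero_iff X := by
    rw [norm_def, ENNReal.toReal_eq_zero_iff, or_iff_left X.traceNorm_lt_top.ne]
    refine ⟨fun h => toOp_injective ?_, fun h => ?_⟩
    · rw [eq_zero_of_traceNorm _ h, map_zero]
    · rw [h, map_zero, traceNorm_zero]

instance : NormedAddCommGroup (TraceClass H) := NormedAddCommGroup.ofCore normCore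

instance : NormedSpace ℂ (TraceClass H) := NormedSpace.ofCore normCore

/-- `U X U*` for a trace class operator `X` and a unitary operator `U`. -/
def conj (U : unitary (H →L[ℂ] H)) (X : TraceClass H) : TraceClass H :=
  mk ((U : H →L[ℂ] H) * X.toOp * star (U : H →L[ℂ] H)) <| by
    rcases subsingleton_or_nontrivial (H →L[ℂ] H) with h | h
    · rw [Subsingleton.elim (_ * star _) X.toOp]
      exact X.traceNorm_lt_top
    · exact (traceNorm_mul_mul_le _ _ _ (CStarRing.norm_coe_unitary U).le
        (by rw [norm_star]; exact (CStarRing.norm_coe_unitary U).le)).trans_lt X.traceNorm_lt_top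

end TraceClass

end TraceClass

/-! ### The Hilbert space tensor product -/

section Tensor

variable {H : Type*} [NormedAddCommGroup H] [InnerProductSpace ℂ H]

variable (H) in
/-- The Hilbert space tensor product `H ⊗ H`: the completion of the algebraic tensor product for
the inner product `⟨x ⊗ y, x' ⊗ y'⟩ = ⟨x, x'⟩ ⟨y, y'⟩`. -/
abbrev HTensor : Type _ := UniformSpace.Completion (H ⊗[ℂ] H)

/-- The elementary tensor `x ⊗ y`, as an element of the Hilbert space tensor product. -/
def tmul (x y : H) : HTensor H := ((x ⊗ₜ[ℂ] y : H ⊗[ℂ] H) : HTensor H)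

/-- The operator `A ⊗ B` on `H ⊗ H`, with `(A ⊗ B)(x ⊗ y) = A x ⊗ B y`. -/
def tensorOp (A B : H →L[ℂ] H) : HTensor H →L[ℂ] HTensor H :=
  (TensorProduct.mapL A B).completion

variable (H) in
/-- The swap operator on `H ⊗ H`, with `S (x ⊗ y) = y ⊗ x`. -/
def swap : HTensor H →L[ℂ] HTensor H :=
  ((TensorProduct.commIsometry ℂ H H).toContinuousLinearEquiv :
    (H ⊗[ℂ] H) →L[ℂ] (H ⊗[ℂ] H)).completion

@[simp] lemma tensorOp_tmul (A B : H →L[ℂ] H) (x y : H) :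
    tensorOp A B (tmul x y) = tmul (A x) (B y) := by
  simp [tensorOp, tmul, ContinuousLinearMap.completion_apply_coe]

@[simp] lemma swap_tmul (x y : H) : swap H (tmul x y) = tmul y x := by
  simp [swap, tmul, ContinuousLinearMap.completion_apply_coe]

@[simp] lemma inner_tmul (x y x' y' : H) :
    ⟪tmul x y, tmul x' y'⟫_ℂ = ⟪x, x'⟫_ℂ * ⟪y, y'⟫_ℂ := by
  simp [tmul]

lemma tmul_smul_smul (a b : ℂ) (x y : H) : tmul (a • x) (b • y) = (a * b) • tmul x y := by
  rw [tmul, tmul, ← UniformSpace.Completion.coe_smul, TensorProduct.smul_tmul_smul]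

/-- The bounded linear map `y ↦ x ⊗ y`. -/
def tmulLeft (x : H) : H →L[ℂ] HTensor H :=
  UniformSpace.Completion.toComplL ∘L TensorProduct.mkL (𝕜 := ℂ) (E := H) (F := H) x

/-- The bounded linear map `x ↦ x ⊗ y`. -/
def tmulRight (y : H) : H →L[ℂ] HTensor H :=
  UniformSpace.Completion.toComplL ∘L (TensorProduct.mkL (𝕜 := ℂ) (E := H) (F := H)).flip y

@[simp] lemma tmulLeft_apply (x y : H) : tmulLeft x y = tmul x y := rfl

@[simp] lemma tmulRight_apply (x y : H) : tmulRight y x = tmul x y := rfl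

/-- Bounded operators on `H ⊗ H` that agree on elementary tensors are equal. -/
lemma op_ext {A B : HTensor H →L[ℂ] HTensor H} (h : ∀ x y, A (tmul x y) = B (tmul x y)) :
    A = B := by
  ext z
  induction z using UniformSpace.Completion.induction_on with
  | hp => exact isClosed_eq A.continuous B.continuous
  | ih z =>
    induction z using TensorProduct.induction_on with
    | zero => rw [UniformSpace.Completion.coe_zero, map_zero, map_zero]
    | tmul x y => exact h x y
    | add x y hx hy => simp only [UniformSpace.Completion.coe_add, map_add, hx, hy]

end Tensor

/-! ### Diagonal operators, classical broadcasting -/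

section Diagonal

variable {K : Type*} [NormedAddCommGroup K] [InnerProductSpace ℂ K] [CompleteSpace K]

open InnerProductSpace in
lemma summable_diag {ι : Type*} {v : ι → K} (hv : Orthonormal ℂ v) (d : ι → ℂ) (C : ℝ)
    (hd : ∀ i, ‖d i‖ ≤ C) (z : K) : Summable fun i => d i • rankOne ℂ (v i) (v i) z := by
  have h := (hv.orthogonalFamily.summable_iff_norm_sq_summable
    (fun i => d i * ⟪v i, z⟫_ℂ)).2 ?_
  · simpa [mul_smul] using h
  · refine Summable.of_nonneg_of_le (fun i => by positivity) (fun i => ?_)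
      ((hv.inner_products_summable z).mul_left (C ^ 2))
    rw [norm_mul, mul_pow]
    gcongr
    exact hd i

open InnerProductSpace in
lemma norm_diag_le {ι : Type*} {v : ι → K} (hv : Orthonormal ℂ v) (d : ι → ℂ) (C : ℝ)
    (hd : ∀ i, ‖d i‖ ≤ C) (z : K) :
    ‖∑' i, d i • rankOne ℂ (v i) (v i) z‖ ≤ |C| * ‖z‖ := by
  refine le_of_tendsto ((summable_diag hv d C hd z).hasSum.norm) (Filter.Eventually.of_forall ?_)
  intro s
  have h1 := hv.orthogonalFamily.norm_sum (fun i => d i * ⟪v i, z⟫_ℂ) s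
  have h2 := hv.sum_inner_products_le z (s := s)
  have h3 : ‖∑ i ∈ s, d i • rankOne ℂ (v i) (v i) z‖ ^ 2 ≤ (|C| * ‖z‖) ^ 2 := by
    calc ‖∑ i ∈ s, d i • rankOne ℂ (v i) (v i) z‖ ^ 2
        = ∑ i ∈ s, ‖d i * ⟪v i, z⟫_ℂ‖ ^ 2 := by rw [← h1]; simp [mul_smul]
      _ ≤ ∑ i ∈ s, C ^ 2 * ‖⟪v i, z⟫_ℂ‖ ^ 2 := by
          refine Finset.sum_le_sum fun i _ => ?_
          rw [norm_mul, mul_pow]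
          gcongr
          exact hd i
      _ ≤ (|C| * ‖z‖) ^ 2 := by
          rw [← Finset.mul_sum, mul_pow, sq_abs]
          gcongr
  exact (pow_le_pow_iff_left₀ (norm_nonneg _) (by positivity) two_ne_zero).1 h3

open InnerProductSpace in
/-- The operator `∑ i, d_i v_i v_i*` for an orthonormal family `v` and bounded coefficients `d`;
the series converges in the strong operator topology. -/
def diagSum {ι : Type*} {v : ι → K} (hv : Orthonormal ℂ v) (d : ι → ℂ) (C : ℝ)
    (hd : ∀ i, ‖d i‖ ≤ C) : K →L[ℂ] K :=
  LinearMap.mkContinuous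
    { toFun := fun z => ∑' i, d i • rankOne ℂ (v i) (v i) z
      map_add' := fun x y => by
        rw [← (summable_diag hv d C hd x).tsum_add (summable_diag hv d C hd y)]
        simp only [map_add, smul_add]
      map_smul' := fun a x => by
        rw [RingHom.id_apply, ← (summable_diag hv d C hd x).tsum_const_smul a]
        simp only [map_smul, smul_comm a] }
    |C| (norm_diag_le hv d C hd)

open InnerProductSpace in
lemma hasSum_diagSum {ι : Type*} {v : ι → K} (hv : Orthonormal ℂ v) (d : ι → ℂ) (C : ℝ)
    (hd : ∀ i, ‖d i‖ ≤ C) (z : K) :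
    HasSum (fun i => d i • rankOne ℂ (v i) (v i) z) (diagSum hv d C hd z) :=
  (summable_diag hv d C hd z).hasSum

lemma norm_inner_apply_le {ι : Type*} {v : ι → K} (hv : Orthonormal ℂ v) (A : K →L[ℂ] K) (i : ι) :
    ‖⟪v i, A (v i)⟫_ℂ‖ ≤ ‖A‖ := by
  refine (norm_inner_le_norm _ _).trans ?_
  simpa [hv.norm_eq_one i] using A.le_opNorm (v i)

/-- `∑ i, ⟨A v_i, v_i⟩ v_i v_i*` for an orthonormal family `v`. -/
def diagonalPart {ι : Type*} {v : ι → K} (hv : Orthonormal ℂ v) (A : K →L[ℂ] K) : K →L[ℂ] K :=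
  diagSum hv (fun i => ⟪v i, A (v i)⟫_ℂ) ‖A‖ (norm_inner_apply_le hv A)

end Diagonal

section Broadcast

variable {H : Type*} [NormedAddCommGroup H] [InnerProductSpace ℂ H] [CompleteSpace H]
variable {ι : Type*}

open InnerProductSpace

lemma orthonormal_tmul (e : HilbertBasis ι ℂ H) :
    Orthonormal ℂ (fun p : ι × ι => tmul (e p.1) (e p.2)) := by
  classical
  rw [orthonormal_iff_ite]
  rintro ⟨i, j⟩ ⟨k, l⟩
  have h := orthonormal_iff_ite.1 e.orthonormal
  simp only [inner_tmul, h, Prod.mk.injEq]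
  split_ifs <;> simp_all

lemma orthonormal_tmul_self (e : HilbertBasis ι ℂ H) :
    Orthonormal ℂ (fun i : ι => tmul (e i) (e i)) :=
  (orthonormal_tmul e).comp (fun i => (i, i)) fun _ _ h => (Prod.mk.inj h).1

lemma tensorOp_rankOne (x y : H) :
    tensorOp (rankOne ℂ x x) (rankOne ℂ y y) = rankOne ℂ (tmul x y) (tmul x y) := by
  refine op_ext fun u w => ?_
  rw [tensorOp_tmul, rankOne_apply, rankOne_apply, rankOne_apply, inner_tmul,
    tmul_smul_smul]

/-- The diagonal operation `D(X) = ∑ i, ⟨X e_i, e_i⟩ e_i e_i*` on `B(H)`, with respect to the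
orthonormal basis `e`. -/
def diagonal (e : HilbertBasis ι ℂ H) (X : H →L[ℂ] H) : H →L[ℂ] H :=
  diagonalPart e.orthonormal X

lemma hasSum_diagonal (e : HilbertBasis ι ℂ H) (X : H →L[ℂ] H) (z : H) :
    HasSum (fun i => ⟪e i, X (e i)⟫_ℂ • rankOne ℂ (e i) (e i) z) (diagonal e X z) :=
  hasSum_diagSum e.orthonormal _ _ (norm_inner_apply_le e.orthonormal X) z

/-- The operation `D ⊗ D` on `B(H ⊗ H)`: the diagonal operation with respect to the product
basis, `(D ⊗ D)(T) = ∑ i j, ⟨T (e_i ⊗ e_j), e_i ⊗ e_j⟩ e_i e_i* ⊗ e_j e_j*`. It sends `A ⊗ B` to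
`D(A) ⊗ D(B)`, see `diagonalTensor_tensorOp`. -/
def diagonalTensor (e : HilbertBasis ι ℂ H) (T : HTensor H →L[ℂ] HTensor H) :
    HTensor H →L[ℂ] HTensor H :=
  diagonalPart (orthonormal_tmul e) T

lemma hasSum_diagonalTensor (e : HilbertBasis ι ℂ H) (T : HTensor H →L[ℂ] HTensor H)
    (z : HTensor H) :
    HasSum (fun p : ι × ι => ⟪tmul (e p.1) (e p.2), T (tmul (e p.1) (e p.2))⟫_ℂ •
      tensorOp (rankOne ℂ (e p.1) (e p.1)) (rankOne ℂ (e p.2) (e p.2)) z)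
      (diagonalTensor e T z) := by
  have h := hasSum_diagSum (orthonormal_tmul e) _ _ (norm_inner_apply_le (orthonormal_tmul e) T) z
  simp only [tensorOp_rankOne]
  exact h

lemma diagSum_apply_self {K κ : Type*} [NormedAddCommGroup K] [InnerProductSpace ℂ K]
    [CompleteSpace K] {v : κ → K} (hv : Orthonormal ℂ v) (d : κ → ℂ) (C : ℝ)
    (hd : ∀ i, ‖d i‖ ≤ C) (k : κ) : diagSum hv d C hd (v k) = d k • v k := by
  classical
  refine (hasSum_diagSum hv d C hd (v k)).unique ?_
  convert hasSum_ite_eq k (d k • v k) using 2 with i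
  rw [rankOne_apply, orthonormal_iff_ite.1 hv]
  split_ifs with h
  · simp [h]
  · simp

lemma diagonalTensor_tensorOp (e : HilbertBasis ι ℂ H) (A B : H →L[ℂ] H) :
    diagonalTensor e (tensorOp A B) = tensorOp (diagonal e A) (diagonal e B) := by
  have h1 : ∀ i j, diagonalTensor e (tensorOp A B) (tmul (e i) (e j)) =
      tensorOp (diagonal e A) (diagonal e B) (tmul (e i) (e j)) := by
    intro i j
    have h2 := diagSum_apply_self (orthonormal_tmul e)
      (fun p => ⟪tmul (e p.1) (e p.2), tensorOp A B (tmul (e p.1) (e p.2))⟫_ℂ) _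
      (norm_inner_apply_le (orthonormal_tmul e) (tensorOp A B)) (i, j)
    rw [tensorOp_tmul, diagonal, diagonal, diagonalPart, diagonalPart, diagSum_apply_self,
      diagSum_apply_self, tmul_smul_smul]
    refine h2.trans ?_
    rw [tensorOp_tmul, inner_tmul]
  have h3 : ∀ x j, diagonalTensor e (tensorOp A B) (tmul x (e j)) =
      tensorOp (diagonal e A) (diagonal e B) (tmul x (e j)) := by
    intro x j
    have : (diagonalTensor e (tensorOp A B)) ∘L tmulRight (e j) =
        (tensorOp (diagonal e A) (diagonal e B)) ∘L tmulRight (e j) := by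
      refine ContinuousLinearMap.ext_on (dense_span_basis e) ?_
      rintro _ ⟨i, rfl⟩
      exact h1 i j
    exact congrArg (fun F => F x) this
  refine op_ext fun x y => ?_
  have : (diagonalTensor e (tensorOp A B)) ∘L tmulLeft x =
      (tensorOp (diagonal e A) (diagonal e B)) ∘L tmulLeft x := by
    refine ContinuousLinearMap.ext_on (dense_span_basis e) ?_
    rintro _ ⟨j, rfl⟩
    exact h3 x j
  exact congrArg (fun F => F y) this

/-- The classical broadcasting `B_cl(X) = ∑ i, ⟨X e_i, e_i⟩ e_i e_i* ⊗ e_i e_i*`. -/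
def classicalBroadcast (e : HilbertBasis ι ℂ H) (X : H →L[ℂ] H) : HTensor H →L[ℂ] HTensor H :=
  diagSum (orthonormal_tmul_self e) (fun i => ⟪e i, X (e i)⟫_ℂ) ‖X‖
    (norm_inner_apply_le e.orthonormal X)

lemma hasSum_classicalBroadcast (e : HilbertBasis ι ℂ H) (X : H →L[ℂ] H) (z : HTensor H) :
    HasSum (fun i => ⟪e i, X (e i)⟫_ℂ •
      tensorOp (rankOne ℂ (e i) (e i)) (rankOne ℂ (e i) (e i)) z) (classicalBroadcast e X z) := by
  simp only [tensorOp_rankOne]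
  exact hasSum_diagSum (orthonormal_tmul_self e) _ _ _ z

lemma traceNorm_diagonal_le (e : HilbertBasis ι ℂ H) (X : H →L[ℂ] H) :
    traceNorm (diagonal e X) ≤ traceNorm X := by
  obtain ⟨W, hW, h⟩ := exists_polar' (diagonal e X)
  have h1 : ‖(1 : H →L[ℂ] H)‖ ≤ 1 := ContinuousLinearMap.norm_id_le
  rw [traceNorm_eq_posTrace e, h]
  refine (posTrace_le _ _).trans (le_trans ?_ (tsum_inner_le e 1 X 1 h1 h1))
  refine ENNReal.tsum_le_tsum fun i => ?_
  rw [mul_apply_eq_comp, diagonal, diagonalPart, diagSum_apply_self, map_smul,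
    inner_smul_right, one_mul, mul_one, enorm_mul]
  refine mul_le_of_le_one_right' ?_
  rw [← ofReal_norm, ← ENNReal.ofReal_one]
  exact ENNReal.ofReal_le_ofReal ((norm_inner_apply_le e.orthonormal W i).trans hW)

/-- The diagonal operation on `T(H)`. -/
def TraceClass.diag (e : HilbertBasis ι ℂ H) (X : TraceClass H) : TraceClass H :=
  TraceClass.mk (diagonal e X.toOp) ((traceNorm_diagonal_le e _).trans_lt X.traceNorm_lt_top)

/-- Covariance under unitary evolution: `Φ(U X U*) = (U ⊗ U) Φ(X) (U* ⊗ U*)` for all `X` in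
`T(H)` and all unitary operators `U` on `H`. -/
def IsUnitarilyCovariant (Φ : TraceClass H → (HTensor H →L[ℂ] HTensor H)) : Prop :=
  ∀ (X : TraceClass H) (U : unitary (H →L[ℂ] H)),
    Φ (TraceClass.conj U X) =
      tensorOp (U : H →L[ℂ] H) U * Φ X * tensorOp (star (U : H →L[ℂ] H)) (star (U : H →L[ℂ] H))

/-- Consistency with classical broadcasting, with respect to the orthonormal basis `e`:
`(D ⊗ D) ∘ Φ ∘ D = B_cl` on `T(H)`. -/
def IsClassicallyConsistent (e : HilbertBasis ι ℂ H)
    (Φ : TraceClass H → (HTensor H →L[ℂ] HTensor H)) : Prop :=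
  ∀ X : TraceClass H,
    diagonalTensor e (Φ (TraceClass.diag e X)) = classicalBroadcast e X.toOp

end Broadcast

/-! ### Partial traces in finite dimension -/

section PartialTrace

variable {H : Type*} [NormedAddCommGroup H] [InnerProductSpace ℂ H] [CompleteSpace H]
variable [FiniteDimensional ℂ H]

/-- The partial trace over the first factor,
`⟨tr₁(T) y, y'⟩ = ∑ i, ⟨T (f_i ⊗ y), f_i ⊗ y'⟩` for an orthonormal basis `f` of `H`. -/
def partialTrace₁ (T : HTensor H →L[ℂ] HTensor H) : H →L[ℂ] H :=
  ∑ i, (tmulLeft (stdOrthonormalBasis ℂ H i)).adjoint ∘L T ∘L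
    tmulLeft (stdOrthonormalBasis ℂ H i)

/-- The partial trace over the second factor,
`⟨tr₂(T) x, x'⟩ = ∑ i, ⟨T (x ⊗ f_i), x' ⊗ f_i⟩` for an orthonormal basis `f` of `H`. -/
def partialTrace₂ (T : HTensor H →L[ℂ] HTensor H) : H →L[ℂ] H :=
  ∑ i, (tmulRight (stdOrthonormalBasis ℂ H i)).adjoint ∘L T ∘L
    tmulRight (stdOrthonormalBasis ℂ H i)

/-- `tr₁(A ⊗ B) = tr(A) B`. -/
lemma partialTrace₁_tensorOp (A B : H →L[ℂ] H) :
    partialTrace₁ (tensorOp A B) = LinearMap.trace ℂ H (A : H →ₗ[ℂ] H) • B := by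
  ext y
  refine ext_inner_left ℂ fun z => ?_
  rw [LinearMap.trace_eq_sum_inner _ (stdOrthonormalBasis ℂ H)]
  simp [partialTrace₁, inner_sum, inner_smul_right, ContinuousLinearMap.adjoint_inner_right,
    Finset.sum_mul]

/-- `tr₂(A ⊗ B) = tr(B) A`. -/
lemma partialTrace₂_tensorOp (A B : H →L[ℂ] H) :
    partialTrace₂ (tensorOp A B) = LinearMap.trace ℂ H (B : H →ₗ[ℂ] H) • A := by
  ext y
  refine ext_inner_left ℂ fun z => ?_
  rw [LinearMap.trace_eq_sum_inner _ (stdOrthonormalBasis ℂ H)]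
  simp [partialTrace₂, inner_sum, inner_smul_right, ContinuousLinearMap.adjoint_inner_right,
    ← Finset.mul_sum, mul_comm]

end PartialTrace

end Broadcasting

end

open scoped InnerProductSpace TensorProduct ENNReal

noncomputable section

set_option linter.unusedSectionVars false

namespace Broadcasting

open InnerProductSpace

/-! ### Trace norm density of the span of the operators `x x*` -/

section TraceClassDensity

variable {H : Type*} [NormedAddCommGroup H] [InnerProductSpace ℂ H] [CompleteSpace H]

/-! The operators `x x*` span a trace-norm dense subspace (`TraceClass.dense_span_proj`) and `Φ` is
continuous, so only `Φ(x x*)` for unit vectors `x` matters. Up to a phase, which `x x*` does not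
see, unitaries act transitively on unit vectors, so by covariance `Φ` is determined by its value at
one projection `P = e_a e_a*`.

The value `Φ(P)` is found from its matrix coefficients in the product basis. Phase unitaries
diagonal in the basis fix `P`, so a coefficient from `e_i ⊗ e_j` to `e_k ⊗ e_l` vanishes unless `{k,
l} = {i, j}` with multiplicity (`coeff_basis_ne_zero`). Classical consistency gives the diagonal
coefficients (`coeff_diag`). Among the remaining swap coefficients, those not involving `a` vanish
by a rotation argument (`coeff_swap_eq_zero`), and those involving `a` take only two values `μ` and
`ν`, by exchanging basis vectors other than `e_a`. Hence `Φ(P) = μ S(I ⊗ P) + ν S(P ⊗ I) + (1 - μ -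
ν) P ⊗ P` (`exists_eq_swapComb_basis`).

Covariance carries this to all unit vectors with the same constants. The last term is quadratic in
the projection and contradicts linearity unless its coefficient is zero (`swapComb_coeff_eq_zero`),
which forces `ν = 1 - μ`. The converse and the partial traces are direct computations on product
vectors. -/

lemma posTrace_star_mul_self {ι : Type*} (e : HilbertBasis ι ℂ H) (B : H →L[ℂ] H) :
    posTrace e (star B * B) = hsSq e B := by
  refine tsum_congr fun i => ?_
  rw [mul_apply_eq_comp, ContinuousLinearMap.star_eq_adjoint,
    ContinuousLinearMap.adjoint_inner_right, inner_self_eq_norm_sq,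
    ENNReal.ofReal_pow (norm_nonneg _), ofReal_norm]

lemma traceNorm_star_mul_self {ι : Type*} (e : HilbertBasis ι ℂ H) (B : H →L[ℂ] H) :
    traceNorm (star B * B) = hsSq e B := by
  rw [traceNorm_eq_posTrace e, absOp, CFC.abs_of_nonneg _ (star_mul_self_nonneg B),
    posTrace_star_mul_self]

lemma traceNorm_rankOne_self_lt_top (x : H) : traceNorm (rankOne ℂ x x) < ∞ := by
  have h0 : (0 : H →L[ℂ] H) ≤ rankOne ℂ x x :=
    (ContinuousLinearMap.nonneg_iff_isPositive _).2 (isPositive_rankOne_self x)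
  rw [traceNorm, absOp, CFC.abs_of_nonneg _ h0, posTrace]
  have h : ∀ i, ENNReal.ofReal (RCLike.re ⟪someBasis H i, rankOne ℂ x x (someBasis H i)⟫_ℂ) ≤
      ‖⟪someBasis H i, x⟫_ℂ‖ₑ ^ 2 := by
    intro i
    rw [rankOne_apply, inner_smul_right]
    refine (ENNReal.ofReal_le_ofReal (RCLike.re_le_norm _)).trans ?_
    rw [norm_mul, norm_inner_symm x, ← sq, ENNReal.ofReal_pow (norm_nonneg _), ofReal_norm]
  refine (ENNReal.tsum_le_tsum h).trans_lt ?_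
  rw [← parseval]
  exact ENNReal.pow_lt_top enorm_lt_top

/-- The operator `x x*`, as a trace class operator. -/
def TraceClass.proj (x : H) : TraceClass H :=
  TraceClass.mk (rankOne ℂ x x) (traceNorm_rankOne_self_lt_top x)

@[simp] lemma TraceClass.toOp_proj (x : H) : (TraceClass.proj x).toOp = rankOne ℂ x x := rfl

/-- Polarization, in the form for a product that is conjugate linear in the second vector. -/
lemma TraceClass.exists_toOp_eq_rankOne (x y : H) :
    ∃ Y ∈ Submodule.span ℂ (Set.range (TraceClass.proj (H := H))), Y.toOp = rankOne ℂ x y := by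
  have h : ∀ z : H, TraceClass.proj z ∈ Submodule.span ℂ (Set.range (TraceClass.proj (H := H))) :=
    fun z => Submodule.subset_span ⟨z, rfl⟩
  refine ⟨(4⁻¹ : ℂ) • (TraceClass.proj (x + y) - TraceClass.proj (x - y) +
    Complex.I • TraceClass.proj (x + Complex.I • y) -
    Complex.I • TraceClass.proj (x - Complex.I • y)),
    Submodule.smul_mem _ _ (Submodule.sub_mem _ (Submodule.add_mem _ (Submodule.sub_mem _ (h _)
      (h _)) (Submodule.smul_mem _ _ (h _))) (Submodule.smul_mem _ _ (h _))), ?_⟩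
  ext z
  simp only [map_smul, map_sub, map_add, TraceClass.toOp_proj, smul_apply, sub_apply, add_apply,
    rankOne_apply, inner_smul_left, Complex.conj_I]
  have hI : Complex.I * Complex.I = -1 := Complex.I_mul_I
  match_scalars
  · linear_combination (-(4 : ℂ)⁻¹ * 2 * ⟪y, z⟫_ℂ) * hI
  · linear_combination ((2 : ℂ)⁻¹ * ⟪x, z⟫_ℂ) * hI

/-- The complement of the projection onto finitely many vectors of an orthonormal basis. -/
def coProj {ι : Type*} (e : HilbertBasis ι ℂ H) (s : Finset ι) : H →L[ℂ] H :=
  1 - ∑ i ∈ s, rankOne ℂ (e i) (e i)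

lemma coProj_apply_basis {ι : Type*} [DecidableEq ι] (e : HilbertBasis ι ℂ H) (s : Finset ι)
    (i : ι) : coProj e s (e i) = if i ∈ s then 0 else e i := by
  simp only [coProj, sub_apply, one_apply_eq_self, sum_apply, rankOne_apply,
    orthonormal_iff_ite.1 e.orthonormal, ite_smul, one_smul, zero_smul, Finset.sum_ite_eq']
  split_ifs <;> simp

lemma coProj_mul_self {ι : Type*} (e : HilbertBasis ι ℂ H) (s : Finset ι) :
    coProj e s * coProj e s = coProj e s := by
  classical
  refine ContinuousLinearMap.ext_on (dense_span_basis e) ?_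
  rintro _ ⟨i, rfl⟩
  rw [mul_apply_eq_comp, coProj_apply_basis]
  split_ifs with h
  · simp
  · simp [coProj_apply_basis, h]

lemma star_coProj {ι : Type*} (e : HilbertBasis ι ℂ H) (s : Finset ι) :
    star (coProj e s) = coProj e s := by
  simp [coProj, star_sum, ContinuousLinearMap.star_eq_adjoint]

/-- With `Q = coProj e s`, a self-adjoint idempotent, `A Q A = (Q A)* (Q A)`. Its trace norm is thus
the squared Hilbert-Schmidt norm of `Q A`, equal to that of the adjoint `A Q`, which kills `e_i` for
`i ∈ s`. -/
lemma traceNorm_mul_coProj_mul {ι : Type*} [DecidableEq ι] (e : HilbertBasis ι ℂ H)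
    (s : Finset ι) (A : H →L[ℂ] H) (hA : star A = A) :
    traceNorm (A * coProj e s * A) = ∑' i, if i ∈ s then 0 else ‖A (e i)‖ₑ ^ 2 := by
  have h : A * coProj e s * A = star (coProj e s * A) * (coProj e s * A) := by
    rw [star_mul, star_coProj, hA, mul_assoc, mul_assoc, ← mul_assoc (coProj e s),
      coProj_mul_self]
  rw [h, traceNorm_star_mul_self e, hsSq_adjoint e e, star_mul, star_coProj, hA]
  refine tsum_congr fun i => ?_
  rw [mul_apply_eq_comp, coProj_apply_basis]
  split_ifs <;> simp

/-- The operators `x x*` span a dense subspace of the space of trace class operators. -/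
lemma TraceClass.dense_span_proj :
    Dense (Submodule.span ℂ (Set.range (TraceClass.proj (H := H))) : Set (TraceClass H)) := by
  classical
  intro X
  rw [Metric.mem_closure_iff]
  intro ε hε
  obtain ⟨W, hW, hX⟩ := exists_polar X.toOp
  set A := sqrtAbs X.toOp
  set e := someBasis H
  have hA : star A = A := star_sqrtAbs _
  have hAA : A * A = absOp X.toOp := sqrtAbs_mul_self _
  have hfin : ∑' i, ‖A (e i)‖ₑ ^ 2 ≠ ∞ := by
    have := X.traceNorm_lt_top
    rw [traceNorm_eq_posTrace e, posTrace_absOp] at this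
    exact this.ne
  obtain ⟨s, hs⟩ := ((ENNReal.tendsto_tsum_compl_atTop_zero hfin).eventually
    (gt_mem_nhds (ENNReal.ofReal_pos.2 hε))).exists
  have hsum : ∑' i, (if i ∈ s then 0 else ‖A (e i)‖ₑ ^ 2) < ENNReal.ofReal ε := by
    refine lt_of_eq_of_lt ?_ hs
    refine Eq.trans ?_ (tsum_subtype {i | i ∉ s} (fun i => ‖A (e i)‖ₑ ^ 2)).symm
    refine tsum_congr fun i => ?_
    by_cases h : i ∈ s
    · rw [if_pos h, Set.indicator_of_notMem]
      exact fun h' => h' h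
    · rw [if_neg h, Set.indicator_of_mem]
      exact h
  -- Inserting the projection onto the `e_i`, `i ∈ s`, between the factors of `X = W A A` gives the
  -- finite sum of the rank-one operators `(W A e_i)(A e_i)*`. The error `W A Q A` has trace norm at
  -- most the tail of the convergent series `∑ ‖A e_i‖²`.
  choose Y hY hYop using fun i => TraceClass.exists_toOp_eq_rankOne (W (A (e i))) (A (e i))
  refine ⟨∑ i ∈ s, Y i, Submodule.sum_mem _ fun i _ => hY i, ?_⟩
  have hdiff : (X - ∑ i ∈ s, Y i).toOp = W * (A * coProj e s * A) * 1 := by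
    rw [map_sub, map_sum]
    conv_lhs => rw [hX, ← hAA]
    simp only [hYop, coProj, mul_sub, sub_mul, mul_one, Finset.mul_sum, Finset.sum_mul]
    congr 1
    refine Finset.sum_congr rfl fun i _ => ?_
    ext z
    simp only [mul_apply_eq_comp, rankOne_apply, map_smul]
    rw [← ContinuousLinearMap.adjoint_inner_right, ← ContinuousLinearMap.star_eq_adjoint, hA]
  rw [dist_eq_norm, TraceClass.norm_def, hdiff]
  have h1 : ‖(1 : H →L[ℂ] H)‖ ≤ 1 := ContinuousLinearMap.norm_id_le
  have h2 := traceNorm_mul_mul_le W (A * coProj e s * A) 1 hW h1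
  rw [traceNorm_mul_coProj_mul e s A hA] at h2
  have h3 := h2.trans_lt hsum
  exact (ENNReal.toReal_lt_of_lt_ofReal h3)

/-- The operator norm of `|X|^{1/2}` is at most its Hilbert-Schmidt norm, whose square is `‖X‖₁`.
Applying this bound twice bounds `|X|`, and `|X| x` and `X x` have the same norm. This makes
evaluation at a vector continuous in the trace norm. -/
lemma norm_apply_le_traceNorm (X : TraceClass H) (x : H) : ‖X.toOp x‖ ≤ ‖X‖ * ‖x‖ := by
  have hb : ∀ y : H, ‖sqrtAbs X.toOp y‖ₑ ^ 2 ≤ traceNorm X.toOp * ‖y‖ₑ ^ 2 := by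
    intro y
    have hA : star (sqrtAbs X.toOp) = sqrtAbs X.toOp := star_sqrtAbs _
    rw [traceNorm, posTrace_absOp, hsSq, parseval (someBasis H), ← ENNReal.tsum_mul_right]
    refine ENNReal.tsum_le_tsum fun i => ?_
    rw [← mul_pow, ← ContinuousLinearMap.adjoint_inner_left,
      ← ContinuousLinearMap.star_eq_adjoint, hA]
    gcongr
    simp only [enorm_eq_nnnorm]
    exact_mod_cast nnnorm_inner_le_nnnorm _ _
  have hb' : ∀ y : H, ‖sqrtAbs X.toOp y‖ ^ 2 ≤ ‖X‖ * ‖y‖ ^ 2 := by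
    intro y
    have := ENNReal.toReal_mono
      (ENNReal.mul_ne_top X.traceNorm_lt_top.ne (ENNReal.pow_ne_top enorm_ne_top)) (hb y)
    simpa [TraceClass.norm_def] using this
  rw [← norm_absOp_apply, ← sqrtAbs_mul_self, mul_apply_eq_comp]
  have h1 := hb' x
  have h2 := hb' (sqrtAbs X.toOp x)
  have h3 : ‖sqrtAbs X.toOp (sqrtAbs X.toOp x)‖ ^ 2 ≤ (‖X‖ * ‖x‖) ^ 2 := by
    calc _ ≤ _ := h2
      _ ≤ ‖X‖ * (‖X‖ * ‖x‖ ^ 2) := by gcongr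
      _ = _ := by ring
  exact (pow_le_pow_iff_left₀ (norm_nonneg _) (by positivity) two_ne_zero).1 h3

/-- Evaluation of a trace class operator at a vector. -/
def TraceClass.evalCLM (x : H) : TraceClass H →L[ℂ] H :=
  LinearMap.mkContinuous
    { toFun := fun X => X.toOp x
      map_add' := fun X Y => by rw [map_add, add_apply]
      map_smul' := fun a X => by rw [map_smul, smul_apply, RingHom.id_apply] }
    ‖x‖ fun X => (norm_apply_le_traceNorm X x).trans_eq (mul_comm _ _)

@[simp] lemma TraceClass.evalCLM_apply (x : H) (X : TraceClass H) :
    TraceClass.evalCLM x X = X.toOp x := rfl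

end TraceClassDensity

/-! ### Phase unitaries and reflections -/

section Unitaries

variable {H : Type*} [NormedAddCommGroup H] [InnerProductSpace ℂ H] [CompleteSpace H]

/-- The unitary operator that multiplies the unit vector `v` by the phase `c` and fixes the
orthogonal complement of `v`. -/
lemma exists_unitary_phase (v : H) (hv : ‖v‖ = 1) (c : ℂ) (hc : ‖c‖ = 1) :
    ∃ U : unitary (H →L[ℂ] H), ∀ z, (U : H →L[ℂ] H) z = z + ((c - 1) * ⟪v, z⟫_ℂ) • v := by
  have hvv : ⟪v, v⟫_ℂ = 1 := by rw [inner_self_eq_norm_sq_to_K, hv]; simp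
  have hcc : c * (starRingEnd ℂ) c = 1 := by rw [RCLike.mul_conj, hc]; simp
  have hs : star (1 + (c - 1) • rankOne ℂ v v : H →L[ℂ] H) =
      1 + ((starRingEnd ℂ) c - 1) • rankOne ℂ v v := by
    simp [ContinuousLinearMap.star_eq_adjoint]
  refine ⟨⟨1 + (c - 1) • rankOne ℂ v v, Unitary.mem_iff.2 ⟨?_, ?_⟩⟩, fun z => ?_⟩
  · rw [hs]
    ext z
    simp only [mul_apply_eq_comp, add_apply, smul_apply, one_apply_eq_self, rankOne_apply,
      inner_add_right, inner_smul_right, hvv]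
    match_scalars
    · ring
    · linear_combination ⟪v, z⟫_ℂ * hcc
  · rw [hs]
    ext z
    simp only [mul_apply_eq_comp, add_apply, smul_apply, one_apply_eq_self, rankOne_apply,
      inner_add_right, inner_smul_right, hvv]
    match_scalars
    · ring
    · linear_combination ⟪v, z⟫_ℂ * hcc
  · simp [smul_smul]

/-- Two unit vectors with real inner product are exchanged by a unitary reflection. -/
lemma exists_unitary_swap (x y : H) (hx : ‖x‖ = 1) (hy : ‖y‖ = 1) (h : ⟪x, y⟫_ℂ = ⟪y, x⟫_ℂ) :
    ∃ U : unitary (H →L[ℂ] H), (U : H →L[ℂ] H) x = y ∧ (U : H →L[ℂ] H) y = x ∧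
      ∀ z, ⟪x, z⟫_ℂ = 0 → ⟪y, z⟫_ℂ = 0 → (U : H →L[ℂ] H) z = z := by
  by_cases hxy : x = y
  · exact ⟨1, by simp [hxy], by simp [hxy], fun z _ _ => by simp⟩
  have hxx : ⟪x, x⟫_ℂ = 1 := by rw [inner_self_eq_norm_sq_to_K, hx]; simp
  have hyy : ⟪y, y⟫_ℂ = 1 := by rw [inner_self_eq_norm_sq_to_K, hy]; simp
  have hr : ‖x - y‖ ≠ 0 := norm_ne_zero_iff.2 (sub_ne_zero.2 hxy)
  have hr' : (‖x - y‖ : ℂ) ≠ 0 := by exact_mod_cast hr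
  -- The only use of the symmetry of the inner product: it makes `⟨x - y, x⟩` equal to half of `‖x -
  -- y‖²`, which is what lets the reflection along `x - y` send `x` to `y`.
  have hsq : (‖x - y‖ : ℂ) ^ 2 = 2 - 2 * ⟪y, x⟫_ℂ := by
    have h1 : ⟪x - y, x - y⟫_ℂ = (‖x - y‖ : ℂ) ^ 2 := inner_self_eq_norm_sq_to_K _
    rw [← h1, inner_sub_left, inner_sub_right, inner_sub_right, hxx, hyy, h]
    ring
  set r := ‖x - y‖
  have hv : ‖((r : ℂ)⁻¹) • (x - y)‖ = 1 := by
    rw [norm_smul, norm_inv, Complex.norm_real, norm_norm]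
    exact inv_mul_cancel₀ hr
  obtain ⟨U, hU⟩ := exists_unitary_phase _ hv (-1) (by simp)
  have hU' : ∀ z, (U : H →L[ℂ] H) z = z + ((-2) * ((r : ℂ) ^ 2)⁻¹ * ⟪x - y, z⟫_ℂ) • (x - y) := by
    intro z
    rw [hU, inner_smul_left, map_inv₀, Complex.conj_ofReal, smul_smul]
    congr 2
    field_simp
    ring
  have hne : (r : ℂ) ^ 2 ≠ 0 := pow_ne_zero _ hr'
  refine ⟨U, ?_, ?_, fun z h1 h2 => ?_⟩
  · have : (-2) * ((r : ℂ) ^ 2)⁻¹ * ⟪x - y, x⟫_ℂ = -1 := by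
      rw [inner_sub_left, hxx]
      field_simp
      rw [hsq]; ring
    rw [hU', this]; module
  · have : (-2) * ((r : ℂ) ^ 2)⁻¹ * ⟪x - y, y⟫_ℂ = 1 := by
      rw [inner_sub_left, hyy, h]
      field_simp
      rw [hsq]; ring
    rw [hU', this]; module
  · rw [hU', inner_sub_left, h1, h2]; simp

/-- Rotating `y` by the phase of `⟨y, x⟩` makes the inner product real, as `exists_unitary_swap`
requires; the operator `y y*` is unaffected. -/
lemma exists_phase_inner_comm (x y : H) :
    ∃ c : ℂ, ‖c‖ = 1 ∧ ⟪x, c • y⟫_ℂ = ⟪c • y, x⟫_ℂ := by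
  by_cases h : ⟪x, y⟫_ℂ = 0
  · refine ⟨1, by simp, ?_⟩
    rw [one_smul, h, ← inner_conj_symm, h, map_zero]
  · have hn : ‖⟪x, y⟫_ℂ‖ ≠ 0 := norm_ne_zero_iff.2 h
    refine ⟨(starRingEnd ℂ) ⟪x, y⟫_ℂ / ‖⟪x, y⟫_ℂ‖, ?_, ?_⟩
    · rw [norm_div, RCLike.norm_conj, Complex.norm_real, norm_norm, div_self hn]
    · rw [inner_smul_right, inner_smul_left, ← inner_conj_symm y x, map_div₀, Complex.conj_conj,
        Complex.conj_ofReal]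
      ring

end Unitaries

/-! ### Operators on the tensor product determined by the product basis -/

section TensorBasics

variable {H : Type*} [NormedAddCommGroup H] [InnerProductSpace ℂ H]

lemma tmul_add_left (x x' y : H) : tmul (x + x') y = tmul x y + tmul x' y :=
  map_add (tmulRight y) x x'

lemma tmul_add_right (x y y' : H) : tmul x (y + y') = tmul x y + tmul x y' :=
  map_add (tmulLeft x) y y'

lemma tmul_smul_left (a : ℂ) (x y : H) : tmul (a • x) y = a • tmul x y :=
  map_smul (tmulRight y) a x

lemma tmul_smul_right (a : ℂ) (x y : H) : tmul x (a • y) = a • tmul x y :=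
  map_smul (tmulLeft x) a y

lemma op_ext_basis {ι : Type*} (e : HilbertBasis ι ℂ H) {A B : HTensor H →L[ℂ] HTensor H}
    (h : ∀ i j, A (tmul (e i) (e j)) = B (tmul (e i) (e j))) : A = B := by
  have h1 : ∀ x j, A (tmul x (e j)) = B (tmul x (e j)) := by
    intro x j
    have : A ∘L tmulRight (e j) = B ∘L tmulRight (e j) := by
      refine ContinuousLinearMap.ext_on (dense_span_basis e) ?_
      rintro _ ⟨i, rfl⟩
      exact h i j
    exact congrArg (fun F => F x) this
  refine op_ext fun x y => ?_
  have : A ∘L tmulLeft x = B ∘L tmulLeft x := by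
    refine ContinuousLinearMap.ext_on (dense_span_basis e) ?_
    rintro _ ⟨j, rfl⟩
    exact h1 x j
  exact congrArg (fun F => F y) this

lemma op_ext_inner {ι : Type*} (e : HilbertBasis ι ℂ H) [CompleteSpace H]
    {A B : HTensor H →L[ℂ] HTensor H}
    (h : ∀ k l i j, ⟪tmul (e k) (e l), A (tmul (e i) (e j))⟫_ℂ =
      ⟪tmul (e k) (e l), B (tmul (e i) (e j))⟫_ℂ) : A = B := by
  refine op_ext_basis e fun i j => ?_
  -- Equality of two vectors of `H ⊗ H` is recast as equality of operators `z ↦ ⟨A t, z⟩ t` and `z ↦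
  -- ⟨B t, z⟩ t`, with `t = e_i ⊗ e_j`, so that `op_ext_basis` applies; taking adjoints and
  -- evaluating at the unit vector `t` recovers `A t = B t`.
  have h1 : ContinuousLinearMap.adjoint (rankOne ℂ (A (tmul (e i) (e j))) (tmul (e i) (e j))) =
      ContinuousLinearMap.adjoint (rankOne ℂ (B (tmul (e i) (e j))) (tmul (e i) (e j))) := by
    rw [adjoint_rankOne, adjoint_rankOne]
    refine op_ext_basis e fun k l => ?_
    rw [rankOne_apply, rankOne_apply, ← inner_conj_symm, h k l i j, inner_conj_symm]
  have h2 := ContinuousLinearMap.adjoint.injective h1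
  have h3 := congrArg (fun F => F (tmul (e i) (e j))) h2
  have h4 : ⟪tmul (e i) (e j), tmul (e i) (e j)⟫_ℂ = 1 := by
    rw [inner_tmul, inner_self_eq_norm_sq_to_K, inner_self_eq_norm_sq_to_K,
      e.orthonormal.norm_eq_one, e.orthonormal.norm_eq_one]
    simp
  simpa only [rankOne_apply, h4, one_smul] using h3

end TensorBasics

/-! ### Matrix coefficients of `Φ(x x*)` -/

section Forms

variable {H : Type*} [NormedAddCommGroup H] [InnerProductSpace ℂ H] [CompleteSpace H]

lemma unitary_star_apply (U : unitary (H →L[ℂ] H)) (x : H) :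
    (star (U : H →L[ℂ] H)) ((U : H →L[ℂ] H) x) = x := by
  rw [← mul_apply_eq_comp, Unitary.coe_star_mul_self, one_apply_eq_self]

lemma unitary_apply_star (U : unitary (H →L[ℂ] H)) (x : H) :
    (U : H →L[ℂ] H) (star (U : H →L[ℂ] H) x) = x := by
  rw [← mul_apply_eq_comp, Unitary.mul_star_self_of_mem U.2, one_apply_eq_self]

lemma unitary_inner (U : unitary (H →L[ℂ] H)) (x y : H) :
    ⟪(U : H →L[ℂ] H) x, (U : H →L[ℂ] H) y⟫_ℂ = ⟪x, y⟫_ℂ := by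
  rw [← ContinuousLinearMap.adjoint_inner_right, ← ContinuousLinearMap.star_eq_adjoint,
    unitary_star_apply]

lemma TraceClass.conj_proj (U : unitary (H →L[ℂ] H)) (x : H) :
    TraceClass.conj U (TraceClass.proj x) = TraceClass.proj ((U : H →L[ℂ] H) x) := by
  refine TraceClass.toOp_injective ?_
  ext z
  simp only [TraceClass.conj, TraceClass.toOp_mk, TraceClass.toOp_proj, mul_apply_eq_comp,
    rankOne_apply, map_smul]
  rw [ContinuousLinearMap.star_eq_adjoint, ContinuousLinearMap.adjoint_inner_right]

lemma TraceClass.proj_smul (c : ℂ) (x : H) :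
    TraceClass.proj (c • x) = ((‖c‖ : ℂ) ^ 2) • TraceClass.proj x := by
  refine TraceClass.toOp_injective ?_
  ext z
  simp only [TraceClass.toOp_proj, rankOne_apply, map_smul, inner_smul_left, smul_smul, smul_apply]
  congr 1
  have := RCLike.conj_mul c
  linear_combination ⟪x, z⟫_ℂ * this

/-- The matrix coefficient `⟨Φ(x x*) (w ⊗ z), u ⊗ v⟩`. -/
def coeff (Φ : TraceClass H → (HTensor H →L[ℂ] HTensor H)) (x u v w z : H) : ℂ :=
  ⟪tmul u v, Φ (TraceClass.proj x) (tmul w z)⟫_ℂ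

lemma tensorOp_unitary_inner (U : unitary (H →L[ℂ] H)) (u v : H) (t : HTensor H) :
    ⟪tmul ((U : H →L[ℂ] H) u) ((U : H →L[ℂ] H) v), tensorOp (U : H →L[ℂ] H) U t⟫_ℂ =
      ⟪tmul u v, t⟫_ℂ := by
  induction t using UniformSpace.Completion.induction_on with
  | hp => exact isClosed_eq (by fun_prop) (by fun_prop)
  | ih t =>
    induction t using TensorProduct.induction_on with
    | zero => rw [UniformSpace.Completion.coe_zero, map_zero, inner_zero_right, inner_zero_right]
    | tmul x y =>
      change ⟪_, tensorOp _ _ (tmul x y)⟫_ℂ = ⟪_, tmul x y⟫_ℂ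
      rw [tensorOp_tmul, inner_tmul, inner_tmul, unitary_inner, unitary_inner]
    | add x y hx hy =>
      simp only [UniformSpace.Completion.coe_add, map_add, inner_add_right, hx, hy]

variable {Φ : TraceClass H →L[ℂ] (HTensor H →L[ℂ] HTensor H)}

lemma coeff_unitary (hΦ : IsUnitarilyCovariant Φ) (U : unitary (H →L[ℂ] H)) (x u v w z : H) :
    coeff Φ ((U : H →L[ℂ] H) x) ((U : H →L[ℂ] H) u) ((U : H →L[ℂ] H) v) ((U : H →L[ℂ] H) w)
      ((U : H →L[ℂ] H) z) = coeff Φ x u v w z := by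
  rw [coeff, ← TraceClass.conj_proj, hΦ, mul_apply_eq_comp, mul_apply_eq_comp, tensorOp_tmul,
    unitary_star_apply, unitary_star_apply, tensorOp_unitary_inner, coeff]

lemma coeff_phase (c : ℂ) (hc : ‖c‖ = 1) (x u v w z : H) :
    coeff Φ (c • x) u v w z = coeff Φ x u v w z := by
  rw [coeff, TraceClass.proj_smul, hc, coeff]
  simp

lemma coeff_smul (c₁ c₂ c₃ c₄ : ℂ) (x u v w z : H) :
    coeff Φ x (c₁ • u) (c₂ • v) (c₃ • w) (c₄ • z) =
      star c₁ * star c₂ * c₃ * c₄ * coeff Φ x u v w z := by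
  simp only [coeff, tmul_smul_smul, map_smul, inner_smul_left, inner_smul_right, map_mul]
  simp only [starRingEnd_apply]
  ring

variable {ι : Type*} {e : HilbertBasis ι ℂ H}

lemma exists_unitary_phase_basis [DecidableEq ι] (e : HilbertBasis ι ℂ H) (p : ι) :
    ∃ U : unitary (H →L[ℂ] H), ∀ i, (U : H →L[ℂ] H) (e i) =
      (if p = i then Complex.I else 1) • e i := by
  obtain ⟨U, hU⟩ := exists_unitary_phase (e p) (e.orthonormal.norm_eq_one p) Complex.I (by simp)
  refine ⟨U, fun i => ?_⟩
  rw [hU, orthonormal_iff_ite.1 e.orthonormal]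
  split_ifs with h
  · subst h; module
  · simp

/-- Multiplying `e_p` by `i` leaves `e_a e_a*` fixed, even for `p = a`, and multiplies the
coefficient by `i ^ (n - m)`, where `m` and `n` count the occurrences of `p` in `(k, l)` and `(i,
j)`. As `|n - m| ≤ 2`, invariance of a nonzero coefficient forces `m = n`; the phase `-1` would miss
a difference of two. -/
lemma coeff_basis_ne_zero (hΦ : IsUnitarilyCovariant Φ) {a i j k l : ι}
    (h : coeff Φ (e a) (e k) (e l) (e i) (e j) ≠ 0) : (k = i ∧ l = j) ∨ (k = j ∧ l = i) := by
  classical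
  have key : ∀ p, star (if p = k then Complex.I else 1) * star (if p = l then Complex.I else 1) *
      (if p = i then Complex.I else 1) * (if p = j then Complex.I else 1) = 1 := by
    intro p
    obtain ⟨U, hU⟩ := exists_unitary_phase_basis e p
    have h1 := coeff_unitary hΦ U (e a) (e k) (e l) (e i) (e j)
    simp only [hU] at h1
    rw [coeff_phase _ (by split_ifs <;> simp), coeff_smul] at h1
    exact mul_right_cancel₀ h (h1.trans (one_mul _).symm)
  have hI : Complex.I ≠ 1 := fun h => by simpa using congrArg Complex.re h
  have hI' : -Complex.I ≠ 1 := fun h => by simpa using congrArg Complex.re h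
  have hm : (-1 : ℂ) ≠ 1 := by norm_num
  have hi : i = k ∨ i = l := by
    by_contra! hc
    have := key i
    simp only [hc.1, hc.2, if_true, if_false, star_one, one_mul] at this
    split_ifs at this <;> simp_all
  have hj : j = k ∨ j = l := by
    by_contra! hc
    have := key j
    simp only [hc.1, hc.2, if_true, if_false, star_one, one_mul] at this
    split_ifs at this <;> simp_all
  have hk : k = i ∨ k = j := by
    by_contra! hc
    have := key k
    simp only [hc.1, hc.2, if_true, if_false, mul_one] at this
    split_ifs at this <;> simp_all
  have hl : l = i ∨ l = j := by
    by_contra! hc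
    have := key l
    simp only [hc.1, hc.2, if_true, if_false, mul_one] at this
    split_ifs at this <;> simp_all
  grind

lemma diagonal_apply_basis (e : HilbertBasis ι ℂ H) (X : H →L[ℂ] H) (i : ι) :
    diagonal e X (e i) = ⟪e i, X (e i)⟫_ℂ • e i := by
  rw [diagonal, diagonalPart, diagSum_apply_self]

lemma diagonalTensor_apply_basis (e : HilbertBasis ι ℂ H) (T : HTensor H →L[ℂ] HTensor H)
    (i j : ι) : diagonalTensor e T (tmul (e i) (e j)) =
      ⟪tmul (e i) (e j), T (tmul (e i) (e j))⟫_ℂ • tmul (e i) (e j) :=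
  diagSum_apply_self (orthonormal_tmul e) _ _ (norm_inner_apply_le (orthonormal_tmul e) T) (i, j)

lemma classicalBroadcast_apply_basis [DecidableEq ι] (e : HilbertBasis ι ℂ H) (X : H →L[ℂ] H)
    (i j : ι) : classicalBroadcast e X (tmul (e i) (e j)) =
      (if i = j then ⟪e i, X (e i)⟫_ℂ else 0) • tmul (e i) (e j) := by
  split_ifs with h
  · subst h
    exact diagSum_apply_self (orthonormal_tmul_self e) _ _ _ i
  · refine (hasSum_classicalBroadcast e X _).unique ?_
    rw [zero_smul]
    convert hasSum_zero using 2 with k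
    rw [tensorOp_rankOne, rankOne_apply, inner_tmul, orthonormal_iff_ite.1 e.orthonormal,
      orthonormal_iff_ite.1 e.orthonormal]
    split_ifs <;> simp_all

/-- The operator `e_a e_a*` is already diagonal, so the consistency condition can be read off at
`e_i ⊗ e_j`. -/
lemma coeff_diag [DecidableEq ι] (hcl : IsClassicallyConsistent e Φ) (a i j : ι) :
    coeff Φ (e a) (e i) (e j) (e i) (e j) = if i = a ∧ j = a then 1 else 0 := by
  have hD : TraceClass.diag e (TraceClass.proj (e a)) = TraceClass.proj (e a) := by
    refine TraceClass.toOp_injective ?_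
    refine ContinuousLinearMap.ext_on (dense_span_basis e) ?_
    rintro _ ⟨i, rfl⟩
    rw [TraceClass.diag, TraceClass.toOp_mk, diagonal_apply_basis]
    simp only [TraceClass.toOp_proj, rankOne_apply, inner_smul_right,
      orthonormal_iff_ite.1 e.orthonormal]
    split_ifs <;> simp_all
  have h := congrArg (fun F => ⟪tmul (e i) (e j), F (tmul (e i) (e j))⟫_ℂ)
    (hcl (TraceClass.proj (e a)))
  simp only [hD, diagonalTensor_apply_basis, classicalBroadcast_apply_basis, inner_smul_right,
    inner_tmul, orthonormal_iff_ite.1 e.orthonormal, if_true, mul_one, TraceClass.toOp_proj,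
    rankOne_apply] at h
  rw [coeff, h]
  by_cases hij : i = j
  · subst hij
    by_cases hi : i = a
    · simp [hi]
    · simp [hi, Ne.symm hi]
  · rw [if_neg hij, if_neg (by grind)]

lemma exists_unitary_perm (e : HilbertBasis ι ℂ H) {a j k : ι} (hj : j ≠ a) (hk : k ≠ a) :
    ∃ U : unitary (H →L[ℂ] H), (U : H →L[ℂ] H) (e j) = e k ∧ (U : H →L[ℂ] H) (e k) = e j ∧
      (U : H →L[ℂ] H) (e a) = e a := by
  classical
  have ho := orthonormal_iff_ite.1 e.orthonormal
  obtain ⟨U, h1, h2, h3⟩ := exists_unitary_swap (e j) (e k) (e.orthonormal.norm_eq_one j)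
    (e.orthonormal.norm_eq_one k) (by simp [ho, eq_comm])
  exact ⟨U, h1, h2, h3 _ (by simp [ho, hj]) (by simp [ho, hk])⟩

lemma norm_pythagorean (e : HilbertBasis ι ℂ H) {i j : ι} (hij : i ≠ j) (s t : ℂ)
    (h : s * star s + t * star t = 1) : ‖s • e i + t • e j‖ = 1 := by
  classical
  have ho := orthonormal_iff_ite.1 e.orthonormal
  have h1 : ⟪s • e i + t • e j, s • e i + t • e j⟫_ℂ = 1 := by
    simp only [inner_add_left, inner_add_right, inner_smul_left, inner_smul_right, ho, if_true,
      if_neg hij, if_neg hij.symm, starRingEnd_apply]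
    linear_combination h
  rw [inner_self_eq_norm_sq_to_K] at h1
  have h2 : ‖s • e i + t • e j‖ ^ 2 = 1 := Complex.ofReal_injective (by simpa using h1)
  exact (pow_eq_one_iff_of_nonneg (norm_nonneg _) two_ne_zero).1 h2

/-- Let `f` be a unit vector in the plane of `e_i` and `e_j`. Some unitary fixes `e_a` and sends
`e_i` to `f`, so the diagonal coefficient of `Φ(e_a e_a*)` at `f ⊗ f` is the one at `e_i ⊗ e_i`,
namely zero. Expanding it in the basis leaves only the two swap coefficients, which are equal. -/
lemma coeff_swap_eq_zero (hΦ : IsUnitarilyCovariant Φ) (hcl : IsClassicallyConsistent e Φ)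
    {a i j : ι} (hi : i ≠ a) (hj : j ≠ a) (hij : i ≠ j) :
    coeff Φ (e a) (e j) (e i) (e i) (e j) = 0 := by
  classical
  have ho := orthonormal_iff_ite.1 e.orthonormal
  have hz : ∀ {k l i j : ι}, ¬ ((k = i ∧ l = j) ∨ (k = j ∧ l = i)) →
      coeff Φ (e a) (e k) (e l) (e i) (e j) = 0 :=
    fun h => by_contra fun h' => h (coeff_basis_ne_zero hΦ h')
  have hd := coeff_diag hcl a
  have hsym : coeff Φ (e a) (e i) (e j) (e j) (e i) = coeff Φ (e a) (e j) (e i) (e i) (e j) := by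
    obtain ⟨U, h1, h2, h3⟩ := exists_unitary_perm e hi hj
    simpa only [h1, h2, h3] using (coeff_unitary hΦ U (e a) (e i) (e j) (e j) (e i)).symm
  -- A rational point of the unit circle keeps the arithmetic exact. Any point with both coordinates
  -- nonzero would do.
  obtain ⟨U, h1, -, h3⟩ := exists_unitary_swap (e i) ((3 / 5 : ℂ) • e i + (4 / 5 : ℂ) • e j)
    (e.orthonormal.norm_eq_one i) (norm_pythagorean e hij _ _ (by simp; norm_num))
    (by
      simp only [inner_add_left, inner_add_right, inner_smul_left, inner_smul_right, ho, if_true,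
        if_neg hij, if_neg hij.symm]
      simp [map_ofNat])
  have h4 := h3 (e a) (by simp [ho, hi]) (by
    simp only [inner_add_left, inner_smul_left, ho, if_neg hi, if_neg hj]
    simp)
  have h5 := coeff_unitary hΦ U (e a) (e i) (e i) (e i) (e i)
  rw [h1, h4, hd, if_neg (by simp [hi])] at h5
  have hlin : ∀ u v w z : H, ⟪tmul u v, Φ (TraceClass.proj (e a)) (tmul w z)⟫_ℂ =
    coeff Φ (e a) u v w z := fun _ _ _ _ => rfl
  simp only [coeff, tmul_add_left, tmul_add_right, tmul_smul_left, tmul_smul_right, map_add,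
    map_smul, inner_add_left, inner_add_right, inner_smul_left, inner_smul_right] at h5
  simp only [hlin] at h5
  rw [hd i i, hd j j, hd i j, hd j i] at h5
  simp only [hi, hj, and_false, if_false] at h5
  simp only [hz (k := i) (l := i) (i := i) (j := j) (by grind),
    hz (k := i) (l := i) (i := j) (j := i) (by grind),
    hz (k := i) (l := i) (i := j) (j := j) (by grind),
    hz (k := j) (l := j) (i := i) (j := j) (by grind),
    hz (k := j) (l := j) (i := j) (j := i) (by grind),
    hz (k := j) (l := j) (i := i) (j := i) (by grind),
    hz (k := i) (l := j) (i := i) (j := i) (by grind),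
    hz (k := i) (l := j) (i := j) (j := j) (by grind),
    hz (k := j) (l := i) (i := i) (j := i) (by grind),
    hz (k := j) (l := i) (i := j) (j := j) (by grind), hsym] at h5
  simp only [map_div₀, map_ofNat] at h5
  -- The two equal terms have total weight `2 (3/5)² (4/5)² = 288/625`.
  linear_combination (625 / 288 : ℂ) * h5

end Forms

/-! ### The form of `Φ` -/

section Main

variable {H : Type*} [NormedAddCommGroup H] [InnerProductSpace ℂ H] [CompleteSpace H]
variable {Φ : TraceClass H →L[ℂ] (HTensor H →L[ℂ] HTensor H)}
variable {ι : Type*} {e : HilbertBasis ι ℂ H}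

/-- The combination `μ S(I ⊗ X) + ν S(X ⊗ I) + γ (X ⊗ X)`. -/
def swapComb (μ ν γ : ℂ) (X : H →L[ℂ] H) : HTensor H →L[ℂ] HTensor H :=
  μ • (swap H * tensorOp 1 X) + ν • (swap H * tensorOp X 1) + γ • tensorOp X X

lemma swapComb_tmul (μ ν γ : ℂ) (X : H →L[ℂ] H) (x y : H) :
    swapComb μ ν γ X (tmul x y) =
      μ • tmul (X y) x + ν • tmul y (X x) + γ • tmul (X x) (X y) := by
  simp [swapComb]

lemma swapComb_unitary (μ ν γ : ℂ) (X : H →L[ℂ] H) (U : unitary (H →L[ℂ] H)) :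
    swapComb μ ν γ ((U : H →L[ℂ] H) * X * star (U : H →L[ℂ] H)) =
      tensorOp (U : H →L[ℂ] H) U * swapComb μ ν γ X *
        tensorOp (star (U : H →L[ℂ] H)) (star (U : H →L[ℂ] H)) := by
  refine op_ext fun x y => ?_
  simp only [mul_apply_eq_comp, tensorOp_tmul, swapComb_tmul, map_add, map_smul,
    unitary_apply_star]

/-- The swap coefficients that involve `a` and another index `j` do not depend on `j`, by the
unitary exchanging `e_b` and `e_j` and fixing `e_a`. The third parameter is forced by the
coefficient at `e_a ⊗ e_a`, where all three terms contribute and the total is 1. -/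
lemma exists_eq_swapComb_basis (hΦ : IsUnitarilyCovariant Φ)
    (hcl : IsClassicallyConsistent e Φ) {a b : ι} (hab : b ≠ a) :
    ∃ μ ν : ℂ, Φ (TraceClass.proj (e a)) = swapComb μ ν (1 - μ - ν) (rankOne ℂ (e a) (e a)) := by
  classical
  have ho := orthonormal_iff_ite.1 e.orthonormal
  have hμ : ∀ j, j ≠ a → coeff Φ (e a) (e a) (e j) (e j) (e a) =
      coeff Φ (e a) (e a) (e b) (e b) (e a) := by
    intro j hj
    obtain ⟨U, h1, -, h3⟩ := exists_unitary_perm e hab hj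
    simpa only [h1, h3] using coeff_unitary hΦ U (e a) (e a) (e b) (e b) (e a)
  have hν : ∀ j, j ≠ a → coeff Φ (e a) (e j) (e a) (e a) (e j) =
      coeff Φ (e a) (e b) (e a) (e a) (e b) := by
    intro j hj
    obtain ⟨U, h1, -, h3⟩ := exists_unitary_perm e hab hj
    simpa only [h1, h3] using coeff_unitary hΦ U (e a) (e b) (e a) (e a) (e b)
  refine ⟨coeff Φ (e a) (e a) (e b) (e b) (e a), coeff Φ (e a) (e b) (e a) (e a) (e b),
    op_ext_inner e fun k l i j => ?_⟩
  change coeff Φ (e a) (e k) (e l) (e i) (e j) = _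
  generalize coeff Φ (e a) (e a) (e b) (e b) (e a) = μ at *
  generalize coeff Φ (e a) (e b) (e a) (e a) (e b) = ν at *
  simp only [swapComb_tmul, rankOne_apply, inner_add_right, inner_smul_right, inner_tmul, ho]
  by_cases h : (k = i ∧ l = j) ∨ (k = j ∧ l = i)
  · rcases h with ⟨rfl, rfl⟩ | ⟨rfl, rfl⟩
    · rw [coeff_diag hcl]
      by_cases h1 : k = a <;> by_cases h2 : l = a
      · simp [h1, h2]
      · simp [h1, h2, Ne.symm h2]
      · simp [h1, h2, Ne.symm h1]
      · simp [h1, Ne.symm h1, Ne.symm h2]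
    · by_cases hkl : k = l
      · subst hkl
        rw [coeff_diag hcl]
        by_cases h1 : k = a
        · simp [h1]
        · simp [h1, Ne.symm h1]
      · by_cases h1 : k = a
        · subst h1
          rw [hμ l (Ne.symm hkl)]
          simp [hkl, Ne.symm hkl]
        · by_cases h2 : l = a
          · subst h2
            rw [hν k hkl]
            simp [hkl, Ne.symm hkl]
          · rw [coeff_swap_eq_zero hΦ hcl h2 h1 (Ne.symm hkl)]
            simp [Ne.symm h1, Ne.symm h2]
  · rw [by_contra fun h' => h (coeff_basis_ne_zero hΦ h')]
    split_ifs <;> simp_all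

lemma eq_swapComb_of_unit (hΦ : IsUnitarilyCovariant Φ) {a : H} (ha : ‖a‖ = 1) {μ ν γ : ℂ}
    (h : Φ (TraceClass.proj a) = swapComb μ ν γ (rankOne ℂ a a)) (x : H) (hx : ‖x‖ = 1) :
    Φ (TraceClass.proj x) = swapComb μ ν γ (rankOne ℂ x x) := by
  obtain ⟨c, hc, hcx⟩ := exists_phase_inner_comm a x
  obtain ⟨U, hU, -, -⟩ := exists_unitary_swap a (c • x) ha (by rw [norm_smul, hc, hx, mul_one]) hcx
  have h1 : TraceClass.proj x = TraceClass.conj U (TraceClass.proj a) := by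
    rw [TraceClass.conj_proj, hU, TraceClass.proj_smul, hc]
    simp
  have h2 : rankOne ℂ x x =
      (U : H →L[ℂ] H) * rankOne ℂ a a * star (U : H →L[ℂ] H) := congrArg TraceClass.toOp h1
  rw [h1, h2, hΦ, h, swapComb_unitary]

/-- Two orthonormal bases of the plane of `e_a` and `e_b` give the same sum of projections, so by
linearity the same sum of values of `Φ`. The diagonal coefficient at `e_a ⊗ e_b` sees only the `γ`
term, as `γ |⟨x, e_a⟩|² |⟨x, e_b⟩|²`: it is zero on the original basis and a nonzero multiple of `γ`
on the rotated one. -/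
lemma swapComb_coeff_eq_zero (e : HilbertBasis ι ℂ H) {μ ν γ : ℂ} {a b : ι} (hab : b ≠ a)
    (h : ∀ x, ‖x‖ = 1 → Φ (TraceClass.proj x) = swapComb μ ν γ (rankOne ℂ x x)) : γ = 0 := by
  classical
  have ho := orthonormal_iff_ite.1 e.orthonormal
  have hf : ∀ x, ‖x‖ = 1 → coeff Φ x (e a) (e b) (e a) (e b) =
      γ * (⟪x, e a⟫_ℂ * ⟪e a, x⟫_ℂ * (⟪x, e b⟫_ℂ * ⟪e b, x⟫_ℂ)) := by
    intro x hx
    rw [coeff, h x hx]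
    simp only [swapComb_tmul, rankOne_apply, inner_smul_right, inner_add_right, inner_tmul, ho,
      if_neg hab, if_neg hab.symm]
    ring
  have hadd : TraceClass.proj ((3 / 5 : ℂ) • e a + (4 / 5 : ℂ) • e b) +
      TraceClass.proj ((4 / 5 : ℂ) • e a + (-3 / 5 : ℂ) • e b) =
      TraceClass.proj (e a) + TraceClass.proj (e b) := by
    refine TraceClass.toOp_injective ?_
    ext z
    simp only [map_add, TraceClass.toOp_proj, add_apply, rankOne_apply,
      inner_smul_left, map_div₀, map_neg, map_ofNat]
    module
  have h1 := congrArg (fun X => ⟪tmul (e a) (e b), Φ X (tmul (e a) (e b))⟫_ℂ) hadd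
  simp only [map_add, add_apply, inner_add_right] at h1
  change coeff Φ _ _ _ _ _ + coeff Φ _ _ _ _ _ = coeff Φ _ _ _ _ _ + coeff Φ _ _ _ _ _ at h1
  rw [hf _ (norm_pythagorean e hab.symm _ _ (by simp; norm_num)),
    hf _ (norm_pythagorean e hab.symm _ _ (by simp; norm_num)),
    hf _ (e.orthonormal.norm_eq_one _), hf _ (e.orthonormal.norm_eq_one _)] at h1
  simp only [inner_add_left, inner_add_right, inner_smul_left, inner_smul_right, ho, if_true,
    if_neg hab, if_neg hab.symm, map_div₀, map_neg, map_ofNat] at h1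
  linear_combination (625 / 288 : ℂ) * h1

lemma exists_ne_of_two_le_rank (e : HilbertBasis ι ℂ H) (hdim : 2 ≤ Module.rank ℂ H) :
    ∃ a b : ι, b ≠ a := by
  by_contra! hc
  have hsub : Subsingleton ι := ⟨fun a b => hc b a⟩
  have hfin : (Set.range e).Finite := Set.finite_range e
  have : FiniteDimensional ℂ (Submodule.span ℂ (Set.range e)) :=
    FiniteDimensional.span_of_finite ℂ hfin
  -- A finite-dimensional span is closed, so here the Hilbert basis spans algebraically and bounds
  -- the rank.
  have htop : Submodule.span ℂ (Set.range e) = ⊤ := by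
    rw [← (Submodule.closed_of_finiteDimensional
      (Submodule.span ℂ (Set.range e))).submodule_topologicalClosure_eq]
    exact e.dense_span
  have h1 := rank_span_le (R := ℂ) (Set.range e)
  rw [htop, rank_top] at h1
  have h2 : Cardinal.mk (Set.range e) ≤ 1 :=
    Cardinal.mk_le_one_iff_set_subsingleton.2 (Set.subsingleton_range e)
  have h3 := hdim.trans (h1.trans h2)
  exact absurd h3 (by norm_num)

lemma exists_eq_of_covariant_of_consistent (hdim : 2 ≤ Module.rank ℂ H)
    (hΦ : IsUnitarilyCovariant Φ) (hcl : IsClassicallyConsistent e Φ) :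
    ∃ μ : ℂ, ∀ X : TraceClass H,
      Φ X = μ • (swap H * tensorOp 1 X.toOp) + (1 - μ) • (swap H * tensorOp X.toOp 1) := by
  obtain ⟨a, b, hab⟩ := exists_ne_of_two_le_rank e hdim
  obtain ⟨μ, ν, h⟩ := exists_eq_swapComb_basis hΦ hcl hab
  have h1 := eq_swapComb_of_unit hΦ (e.orthonormal.norm_eq_one a) h
  have h2 := swapComb_coeff_eq_zero e hab h1
  have hν : ν = 1 - μ := by linear_combination -h2
  refine ⟨μ, fun X => op_ext fun u v => ?_⟩
  -- At a fixed `u ⊗ v` both sides are continuous and linear in `X` for the trace norm, so they need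
  -- only be compared on the operators `x x*`.
  have hL : (ContinuousLinearMap.apply ℂ _ (tmul u v)) ∘L Φ =
      μ • (tmulRight u ∘L TraceClass.evalCLM v) +
        (1 - μ) • (tmulLeft v ∘L TraceClass.evalCLM u) := by
    refine ContinuousLinearMap.ext_on TraceClass.dense_span_proj ?_
    rintro _ ⟨x, rfl⟩
    change Φ (TraceClass.proj x) (tmul u v) = _
    have h3 : ∀ y, ‖y‖ = 1 → Φ (TraceClass.proj y) (tmul u v) =
        μ • tmul (rankOne ℂ y y v) u + (1 - μ) • tmul v (rankOne ℂ y y u) := by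
      intro y hy
      rw [h1 y hy, h2, swapComb_tmul, hν, zero_smul, add_zero]
    have h4 : ∃ (c : ℂ) (y : H), TraceClass.proj x = c • TraceClass.proj y ∧ (‖y‖ = 1) := by
      by_cases hx : x = 0
      · refine ⟨0, e a, ?_, e.orthonormal.norm_eq_one a⟩
        have := TraceClass.proj_smul 0 x
        rw [zero_smul] at this
        simpa [hx] using this
      -- The scalar is `‖x‖²`; the doubled norm matches the form of `TraceClass.proj_smul`.
      · refine ⟨((‖(‖x‖ : ℂ)‖ : ℂ)) ^ 2, (‖x‖ : ℂ)⁻¹ • x, ?_, norm_smul_inv_norm hx⟩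
        rw [← TraceClass.proj_smul, smul_inv_smul₀]
        exact_mod_cast norm_ne_zero_iff.2 hx
    obtain ⟨c, y, hxy, hy⟩ := h4
    rw [hxy, map_smul, map_smul, smul_apply, h3 y hy]
    rfl
  have := congrArg (fun F => F X) hL
  simpa using this

lemma isUnitarilyCovariant_of_eq {μ : ℂ} (h : ∀ X : TraceClass H,
      Φ X = μ • (swap H * tensorOp 1 X.toOp) + (1 - μ) • (swap H * tensorOp X.toOp 1)) :
    IsUnitarilyCovariant Φ := by
  intro X U
  have h' : ∀ X : TraceClass H, Φ X = swapComb μ (1 - μ) 0 X.toOp := fun X => by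
    rw [h, swapComb, zero_smul, add_zero]
  rw [h', h', TraceClass.conj, TraceClass.toOp_mk, swapComb_unitary]

/-- For `Y = D(X)`, the diagonal coefficients of `S(I ⊗ Y)` and `S(Y ⊗ I)` at `e_i ⊗ e_j` are both
`⟨X e_i, e_i⟩` if `i = j` and zero otherwise, and the weights `μ` and `1 - μ` add up to 1. -/
lemma isClassicallyConsistent_of_eq {μ : ℂ} (h : ∀ X : TraceClass H,
      Φ X = μ • (swap H * tensorOp 1 X.toOp) + (1 - μ) • (swap H * tensorOp X.toOp 1)) :
    IsClassicallyConsistent e Φ := by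
  classical
  intro X
  have ho := orthonormal_iff_ite.1 e.orthonormal
  refine op_ext_basis e fun i j => ?_
  rw [diagonalTensor_apply_basis, classicalBroadcast_apply_basis, h]
  congr 1
  simp only [add_apply, smul_apply, mul_apply_eq_comp, tensorOp_tmul, swap_tmul,
    one_apply_eq_self, TraceClass.diag, TraceClass.toOp_mk, diagonal_apply_basis, inner_add_right,
    inner_smul_right, inner_tmul, ho]
  by_cases hij : i = j
  · subst hij
    simp
    ring
  · simp [hij, Ne.symm hij]

/-! ### Partial traces of the two swap terms -/

section FiniteDim

variable [FiniteDimensional ℂ H]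

lemma adjoint_tmulLeft_tmul (f x y : H) :
    (tmulLeft f).adjoint (tmul x y) = ⟪f, x⟫_ℂ • y := by
  refine ext_inner_left ℂ fun z => ?_
  rw [ContinuousLinearMap.adjoint_inner_right, tmulLeft_apply, inner_tmul, inner_smul_right]

lemma adjoint_tmulRight_tmul (f x y : H) :
    (tmulRight f).adjoint (tmul x y) = ⟪f, y⟫_ℂ • x := by
  refine ext_inner_left ℂ fun z => ?_
  rw [ContinuousLinearMap.adjoint_inner_right, tmulRight_apply, inner_tmul, inner_smul_right,
    mul_comm]

/-- Applied to `y`, the two terms give `∑ ⟨f_i, X y⟩ f_i` and `∑ ⟨f_i, y⟩ X f_i` (inner product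
linear in the second slot); both are basis expansions of `X y`. -/
lemma partialTrace₁_swap (μ ν : ℂ) (X : H →L[ℂ] H) :
    partialTrace₁ (μ • (swap H * tensorOp 1 X) + ν • (swap H * tensorOp X 1)) = (μ + ν) • X := by
  ext y
  simp only [partialTrace₁, sum_apply, ContinuousLinearMap.comp_apply, add_apply, smul_apply,
    mul_apply_eq_comp, tmulLeft_apply, tensorOp_tmul, swap_tmul, one_apply_eq_self, map_add,
    map_smul, adjoint_tmulLeft_tmul, Finset.sum_add_distrib, ← Finset.smul_sum]
  rw [(stdOrthonormalBasis ℂ H).sum_repr' (X y)]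
  simp only [← map_smul, ← map_sum]
  rw [(stdOrthonormalBasis ℂ H).sum_repr' y, add_smul, map_add]

lemma partialTrace₂_swap (μ ν : ℂ) (X : H →L[ℂ] H) :
    partialTrace₂ (μ • (swap H * tensorOp 1 X) + ν • (swap H * tensorOp X 1)) = (μ + ν) • X := by
  ext y
  simp only [partialTrace₂, sum_apply, ContinuousLinearMap.comp_apply, add_apply, smul_apply,
    mul_apply_eq_comp, tmulRight_apply, tensorOp_tmul, swap_tmul, one_apply_eq_self, map_add,
    map_smul, adjoint_tmulRight_tmul, Finset.sum_add_distrib, ← Finset.smul_sum]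
  rw [(stdOrthonormalBasis ℂ H).sum_repr' (X y)]
  simp only [← map_smul, ← map_sum]
  rw [(stdOrthonormalBasis ℂ H).sum_repr' y, add_smul, map_add]

end FiniteDim

end Main

end Broadcasting

end

open Broadcasting in
theorem corollary6 {H : Type*} [NormedAddCommGroup H] [InnerProductSpace ℂ H] [CompleteSpace H]
    [TopologicalSpace.SeparableSpace H] (hdim : 2 ≤ Module.rank ℂ H)
    {ι : Type*} (e : HilbertBasis ι ℂ H)
    (Φ : TraceClass H →L[ℂ] (HTensor H →L[ℂ] HTensor H)) :
    ((IsUnitarilyCovariant Φ ∧ IsClassicallyConsistent e Φ) ↔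
      ∃ μ : ℂ, ∀ X : TraceClass H,
        Φ X = μ • (swap H * tensorOp 1 X.toOp) + (1 - μ) • (swap H * tensorOp X.toOp 1)) ∧
    (∀ _ : FiniteDimensional ℂ H,
      IsUnitarilyCovariant Φ ∧ IsClassicallyConsistent e Φ →
        ∀ X : TraceClass H,
          partialTrace₁ (Φ X) = X.toOp ∧ partialTrace₂ (Φ X) = X.toOp) := by
  refine ⟨⟨fun h => exists_eq_of_covariant_of_consistent hdim h.1 h.2, fun ⟨μ, h⟩ =>
    ⟨isUnitarilyCovariant_of_eq h, isClassicallyConsistent_of_eq h⟩⟩, fun _ h X => ?_⟩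
  obtain ⟨μ, hμ⟩ := exists_eq_of_covariant_of_consistent hdim h.1 h.2
  rw [hμ X, partialTrace₁_swap, partialTrace₂_swap, add_sub_cancel, one_smul]
  exact ⟨rfl, rfl⟩
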